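/- **Setting.** A contextual linear partial monitoring game consists of a context set $\mathcal Z$, a compact (metrizable) action set $\mathcal A$, non-empty closed sets $\mathcal A(z)\subset\mathcal A$ of available actions depending measurably on $z\in\mathcal Z$, reward features $\phi_a^z\in\mathbb R^d$ and feedback maps $M_a^z\in\mathbb R^{m\times d}$, continuous in $a$ and measurable in $z$. The parameter set is $\mathbb R^d$; the unknown parameter is $\theta^*$ with $\|\theta^*\|_2\le B$. Assume $\|\phi_a^z-\phi_b^z\|_2\le 1$ and $\|M_a^z\|\le L$ (spectral norm) for all $z$ and $a,b\in\mathcal A(z)$. Put $\Delta(a,z)=\max_{b\in\mathcal A(z)}\langle\phi_b^z-\phi_a^z,\theta^*\rangle$ and $\Delta_{\max}=\sup_{z}\max_{a,b\in\mathcal A(z)}\langle\phi_a^z-\phi_b^z,\theta^*\rangle$. In round $t=1,2,\dots$ a context $z_t$ with known law $\chi$, independent of the past, is drawn, the learner chooses $a_t\in\mathcal A(z_t)$ and observes $y_t=M_{a_t}^{z_t}\theta^*+\epsilon_t$, where $\epsilon_t$ is $\rho$-sub-Gaussian given the past, $z_t$ and $a_t$: $\mathbb E[e^{\langle u,\epsilon_t\rangle}\mid\cdot]\le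 e^{\|u\|^2\rho^2/2}$ for all $u\in\mathbb R^m$. The expected regret is $\mathbb E[\mathfrak R_n]=\mathbb E\big[\sum_{t=1}^n\Delta(a_t,z_t)\big]$, over contexts, noise and actions. **Algorithm (contextual IDS).** Let $\lambda>0$, $\lambda\ge L^2$, $$V_t=\lambda I_d+\sum_{s<t}(M_{a_s}^{z_s})^\top M_{a_s}^{z_s},\quad \hat\theta_t=V_t^{-1}\sum_{s<t}(M_{a_s}^{z_s})^\top y_s,\quad \beta_t^{1/2}=\rho\sqrt{2\log t^2+\log\det V_t-\log\det(\lambda I_d)}+\sqrt\lambda B,$$ $$\mathcal E_t=\{\theta:\|\theta-\hat\theta_t\|_{V_t}^2\le\beta_t\},\quad \hat\Delta_t(a,z)=\max_{b\in\mathcal A(z)}\max_{\theta\in\mathcal E_t}\langle\phi_b^z-\phi_a^z,\theta\rangle,\quad I_t(a,z)=\tfrac12\log\det\big(I_m+M_a^zV_t^{-1}(M_a^z)^\top\big).$$ For a probability kernel $\xi$ with $\xi(\cdot|z)$ supported on $\mathcal A(z)$ write $\hat\Delta_t(\xi,\chi)=\int\!\int\hat\Delta_t(a,z)\,d\xi(a|z)\,d\chi(z)$,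 and likewise $I_t(\xi,\chi)$. Contextual IDS takes $\xi_t\in\arg\min_\xi\hat\Delta_t(\xi,\chi)^2/I_t(\xi,\chi)$ over all such kernels and samples $a_t\sim\xi_t(\cdot|z_t)$. Let $\gamma_n=\sum_{t=1}^nI_t(a_t,z_t)$. **Alignment constant.** Let $\mathcal P(z)$ be the set of $a\in\mathcal A(z)$ that maximise $b\mapsto\langle\phi_b^z,\theta\rangle$ over $\mathcal A(z)$ for some $\theta\in\mathbb R^d$ for which every other maximiser $b$ is a duplicate of $a$, i.e. $\phi_b^z=\phi_a^z$. Define $$\alpha(\chi)=\sup_{\omega}\ \sup_{a,b}\ \inf_{c}\ \frac{\big(\int\langle\phi_{a(z)}^z-\phi_{b(z)}^z,\omega^z\rangle\,d\chi(z)\big)^2}{\int\int\|M_{c(z')}^{z'}\omega^z\|^2\,d\chi(z)\,d\chi(z')}\in[0,\infty],$$ over $\chi$-integrable $\omega:\mathcal Z\to\mathbb R^d$ and measurable $a,b,c:\mathcal Z\to\mathcal A$ with $a(z),b(z)\in\mathcal P(z)$ and $c(z)\in\mathcal A(z)$ for all $z$. In all ratios $0/0=0$ and $x/0=\infty$ for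 $x>0$. **Theorem.** There is a universal constant $C$ such that, whenever $\alpha(\chi)<\infty$, contextual IDS satisfies for every $n\ge1$ $$\mathbb E[\mathfrak R_n]\le n^{2/3}\big(54\,\alpha(\chi)\,\mathbb E[\beta_n]\,\mathbb E[\gamma_n]\,(\Delta_{\max}+4B)\big)^{1/3}+C\,\Delta_{\max}.$$ -/

import Mathlib

open MeasureTheory ProbabilityTheory
open scoped ENNReal

noncomputable section

namespace LinearPM

/-- Euclidean space of dimension `k`. -/
abbrev Vec (k : ℕ) : Type := EuclideanSpace ℝ (Fin k)

/-- Matrix-vector product on Euclidean spaces. -/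
def app {k l : ℕ} (M : Matrix (Fin l) (Fin k) ℝ) (v : Vec k) : Vec l :=
  WithLp.toLp 2 (M.mulVec v.ofLp)

/-- A contextual linear partial monitoring game with contexts `Z`, actions `A`, parameter set `ℝ^d`
and observations in `ℝ^m`. The fields after `obs` are the regularity under which the integrals and
extrema below make sense: the sets of available actions are non-empty, closed and depend measurably
on the context, features and feedback maps are continuous in the action and measurable in the
context. All of them but non-emptiness are automatic if `Z` and `A` are finite and discrete. -/
structure ContextualGame (Z A : Type*) [MeasurableSpace Z] [TopologicalSpace A] (d m : ℕ) where
  /-- the actions available in context `z` -/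
  avail : Z → Set A
  /-- the reward feature of action `a` in context `z` -/
  feat : Z → A → Vec d
  /-- the feedback map of action `a` in context `z` -/
  obs : Z → A → Matrix (Fin m) (Fin d) ℝ
  avail_nonempty : ∀ z, (avail z).Nonempty
  avail_closed : ∀ z, IsClosed (avail z)
  avail_measurable : ∀ F : Set A, IsClosed F → MeasurableSet {z | (avail z ∩ F).Nonempty}
  feat_continuous : ∀ z, Continuous (feat z)
  feat_measurable : ∀ a, Measurable fun z => feat z a
  obs_continuous : ∀ z, Continuous (obs z)
  obs_measurable : ∀ a i j, Measurable fun z => obs z a i j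

/-- The histories (context, action, observation) of the first `t` rounds. -/
abbrev History (Z A : Type*) (m t : ℕ) : Type _ := Fin t → Z × A × Vec m

namespace ContextualGame

variable {Z A : Type*} [MeasurableSpace Z] [TopologicalSpace A] {d m : ℕ}

/-! ### Gaps, Pareto optimal actions, alignment constant -/

/-- The gap `Δ(a, z | θ)` of action `a` in context `z` under the parameter `θ`. -/
def gap (G : ContextualGame Z A d m) (θ : Vec d) (a : A) (z : Z) : ℝ :=
  sSup {r | ∃ b ∈ G.avail z, r = inner ℝ (G.feat z b - G.feat z a) θ}

/-- The maximal gap `Δ_max` under the parameter `θ`. -/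
def maxGap (G : ContextualGame Z A d m) (θ : Vec d) : ℝ :=
  sSup {r | ∃ z, ∃ a ∈ G.avail z, ∃ b ∈ G.avail z, r = inner ℝ (G.feat z a - G.feat z b) θ}

/-- The Pareto optimal actions of context `z`: the actions that are, for some parameter, optimal,
and uniquely so up to duplicates (actions with the same feature). -/
def pareto (G : ContextualGame Z A d m) (z : Z) : Set A :=
  {a | a ∈ G.avail z ∧ ∃ θ : Vec d,
    (∀ b ∈ G.avail z, inner ℝ (G.feat z b) θ ≤ inner ℝ (G.feat z a) θ) ∧
    ∀ b ∈ G.avail z, inner ℝ (G.feat z b) θ = inner ℝ (G.feat z a) θ → G.feat z b = G.feat z a}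

/-- Measurable functions that assign each context an available action. -/
def Selections [MeasurableSpace A] (G : ContextualGame Z A d m) : Set (Z → A) :=
  {c | Measurable c ∧ ∀ z, c z ∈ G.avail z}

/-- Measurable functions that assign each context a Pareto optimal action. -/
def ParetoSelections [MeasurableSpace A] (G : ContextualGame Z A d m) : Set (Z → A) :=
  {a | Measurable a ∧ ∀ z, a z ∈ G.pareto z}

/-- The contextual global alignment constant `α(χ)`, with the conventions `0 / 0 = 0` and
`x / 0 = ∞` for `x > 0`. -/
def alignment [MeasurableSpace A] (G : ContextualGame Z A d m) (χ : Measure Z) : ℝ≥0∞ :=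
  ⨆ (ω : Z → Vec d) (_ : Measurable ω) (_ : Integrable ω χ)
    (a ∈ G.ParetoSelections) (b ∈ G.ParetoSelections), ⨅ c ∈ G.Selections,
      ENNReal.ofReal ((∫ z, inner ℝ (G.feat z (a z) - G.feat z (b z)) (ω z) ∂χ) ^ 2) /
        ∫⁻ z', ∫⁻ z, ENNReal.ofReal (‖app (G.obs z' (c z')) (ω z)‖ ^ 2) ∂χ ∂χ

/-! ### Quantities computed from a history of `t` rounds, for use in the next round `t + 1` -/

/-- `V = λ I + ∑ₛ Mₛᵀ Mₛ`. -/
def gram (G : ContextualGame Z A d m) (lam : ℝ) {t : ℕ} (h : History Z A m t) :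
    Matrix (Fin d) (Fin d) ℝ :=
  lam • (1 : Matrix (Fin d) (Fin d) ℝ) +
    ∑ s, (G.obs (h s).1 (h s).2.1).transpose * G.obs (h s).1 (h s).2.1

/-- The regularised least squares estimate `V⁻¹ ∑ₛ Mₛᵀ yₛ`. -/
def thetaHat (G : ContextualGame Z A d m) (lam : ℝ) {t : ℕ} (h : History Z A m t) : Vec d :=
  app (G.gram lam h)⁻¹ (∑ s, app (G.obs (h s).1 (h s).2.1).transpose (h s).2.2)

/-- The confidence coefficient `β` of round `t + 1`, at the confidence level `δ = 1 / (t + 1)²`. -/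
def beta (G : ContextualGame Z A d m) (lam B rho : ℝ) {t : ℕ} (h : History Z A m t) : ℝ :=
  (rho * Real.sqrt (2 * Real.log (1 / (1 / ((t : ℝ) + 1) ^ 2)) + Real.log (G.gram lam h).det
      - Real.log (lam • (1 : Matrix (Fin d) (Fin d) ℝ)).det) + Real.sqrt lam * B) ^ 2

/-- The confidence set `{θ : ‖θ - θ̂‖_V² ≤ β}`. -/
def confSet (G : ContextualGame Z A d m) (lam B rho : ℝ) {t : ℕ} (h : History Z A m t) :
    Set (Vec d) :=
  {θ | inner ℝ (θ - G.thetaHat lam h) (app (G.gram lam h) (θ - G.thetaHat lam h))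
    ≤ G.beta lam B rho h}

/-- The gap estimate: the largest gap of `a` in context `z` under a plausible parameter. -/
def gapEst (G : ContextualGame Z A d m) (lam B rho : ℝ) {t : ℕ} (h : History Z A m t)
    (a : A) (z : Z) : ℝ :=
  sSup {r | ∃ b ∈ G.avail z, ∃ θ ∈ G.confSet lam B rho h,
    r = inner ℝ (G.feat z b - G.feat z a) θ}

/-- The information gain `½ log det (I + M V⁻¹ Mᵀ)` of action `a` in context `z`. -/
def infoGain (G : ContextualGame Z A d m) (lam : ℝ) {t : ℕ} (h : History Z A m t)
    (a : A) (z : Z) : ℝ :=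
  1 / 2 * Real.log
    (1 + G.obs z a * (G.gram lam h)⁻¹ * (G.obs z a).transpose : Matrix (Fin m) (Fin m) ℝ).det

variable [MeasurableSpace A]

/-- The probability kernels that assign each context a distribution on its available actions. -/
def Kernels (G : ContextualGame Z A d m) : Set (Kernel Z A) :=
  {ξ | IsMarkovKernel ξ ∧ ∀ z, ξ z (G.avail z)ᶜ = 0}

/-- The integrated gap estimate of a kernel. -/
def gapEstAvg (G : ContextualGame Z A d m) (lam B rho : ℝ) (χ : Measure Z) {t : ℕ}
    (h : History Z A m t) (ξ : Kernel Z A) : ℝ≥0∞ :=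
  ∫⁻ z, ∫⁻ a, ENNReal.ofReal (G.gapEst lam B rho h a z) ∂(ξ z) ∂χ

/-- The integrated information gain of a kernel. -/
def infoGainAvg (G : ContextualGame Z A d m) (lam : ℝ) (χ : Measure Z) {t : ℕ}
    (h : History Z A m t) (ξ : Kernel Z A) : ℝ≥0∞ :=
  ∫⁻ z, ∫⁻ a, ENNReal.ofReal (G.infoGain lam h a z) ∂(ξ z) ∂χ

/-- The contextual information ratio, with `0 / 0 = 0` and `x / 0 = ∞` for `x > 0`. -/
def infoRatio (G : ContextualGame Z A d m) (lam B rho : ℝ) (χ : Measure Z) {t : ℕ}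
    (h : History Z A m t) (ξ : Kernel Z A) : ℝ≥0∞ :=
  (G.gapEstAvg lam B rho χ h ξ) ^ 2 / G.infoGainAvg lam χ h ξ

/-- A policy `ξ` (for each round a kernel from the past history and the present context to actions)
is contextual information-directed sampling if after every history it uses a minimiser of the
contextual information ratio over all kernels. -/
structure IsContextualIDS (G : ContextualGame Z A d m) (lam B rho : ℝ) (χ : Measure Z)
    (ξ : ∀ t : ℕ, Kernel (History Z A m t × Z) A) : Prop where
  isMarkov : ∀ t, IsMarkovKernel (ξ t)
  mem_kernels : ∀ t (h : History Z A m t), (ξ t).sectR h ∈ G.Kernels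
  isMin : ∀ t (h : History Z A m t),
    IsMinOn (G.infoRatio lam B rho χ h) G.Kernels ((ξ t).sectR h)

/-! ### The interaction -/

variable {Ω : Type*}

/-- The history of the first `t` rounds of an interaction. -/
def hist (z : ℕ → Ω → Z) (a : ℕ → Ω → A) (y : ℕ → Ω → Vec m) (t : ℕ) (o : Ω) :
    History Z A m t :=
  fun s => (z s o, a s o, y s o)

/-- `z`, `a`, `y` are the contexts, actions and observations of the first `n` rounds (numbered
from `0`) of the interaction of the policy `ξ` with the instance `θ` of the game: each context has
law `χ` and is independent of the past, the action is drawn from `ξ` given the past and the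
context, and the noise `y - M θ` is `rho`-sub-Gaussian given the past, the context and the
action. -/
structure IsInteraction [MeasurableSpace Ω] (G : ContextualGame Z A d m) (χ : Measure Z)
    (θ : Vec d) (rho : ℝ) (ξ : ∀ t : ℕ, Kernel (History Z A m t × Z) A) (n : ℕ) (P : Measure Ω)
    (z : ℕ → Ω → Z) (a : ℕ → Ω → A) (y : ℕ → Ω → Vec m) : Prop where
  measurable_context : ∀ t, Measurable (z t)
  measurable_action : ∀ t, Measurable (a t)
  measurable_observation : ∀ t, Measurable (y t)
  context_law : ∀ t < n, P.map (z t) = χ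
  context_indep : ∀ t < n, IndepFun (hist z a y t) (z t) P
  action_law : ∀ t < n, P.map (fun o => ((hist z a y t o, z t o), a t o)) =
    (P.map fun o => (hist z a y t o, z t o)).compProd (ξ t)
  noise_integrable : ∀ t < n, ∀ u : Vec m,
    Integrable (fun o => Real.exp (inner ℝ u (y t o - app (G.obs (z t o) (a t o)) θ))) P
  noise_subGaussian : ∀ t < n, ∀ u : Vec m,
    P[fun o => Real.exp (inner ℝ u (y t o - app (G.obs (z t o) (a t o)) θ)) |
      MeasurableSpace.comap (fun o => ((hist z a y t o, z t o), a t o)) inferInstance]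
      ≤ᵐ[P] fun _ => Real.exp (‖u‖ ^ 2 * rho ^ 2 / 2)

/-- The (random) regret of the first `n` rounds. -/
def regret (G : ContextualGame Z A d m) (θ : Vec d) (z : ℕ → Ω → Z) (a : ℕ → Ω → A) (n : ℕ)
    (o : Ω) : ℝ :=
  ∑ t ∈ Finset.range n, G.gap θ (a t o) (z t o)

/-- The total information gain `γ_n` of the first `n` rounds. -/
def totalInfo (G : ContextualGame Z A d m) (lam : ℝ) (z : ℕ → Ω → Z) (a : ℕ → Ω → A)
    (y : ℕ → Ω → Vec m) (n : ℕ) (o : Ω) : ℝ :=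
  ∑ t ∈ Finset.range n, G.infoGain lam (hist z a y t o) (a t o) (z t o)

end ContextualGame

end LinearPM

end

noncomputable section

namespace LinearPM

/-! ### Measurable selection of minimisers -/

section Selection

variable {X A : Type*} [MeasurableSpace X] [TopologicalSpace A] [CompactSpace A]
  [TopologicalSpace.MetrizableSpace A]

/-! Consider a round whose confidence set contains the true parameter. Let w = √β, let Δ be the
maximal gap, and let X and I be the integrated gap estimate and information of the IDS kernel. A
plausible parameter moves ⟨v, θ̂⟩ by at most w‖v‖ in the norm of V⁻¹. In each context take the
greedy action g for θ̂, an action a whose feature is farthest from that of g, and an action b whose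
feature is farthest from that of a. Farthest points are exposed points, so a and b are Pareto
optimal (`mem_pareto_of_farthest`), and r(z) = ‖φ_a - φ_b‖ controls all feature differences in that
context. The greedy kernel has gap estimate at most q = w ∫ r dχ.

Test the alignment constant with ω^z, the V-unit vector dual to φ_a - φ_b. The information of an
action dominates ‖Mω‖² for V-unit ω, so some selection c has q² ≤ 4αβ I(c), for any constant α
strictly above the alignment constant (`exists_selection_sq_integral_le`).

Compare the IDS kernel with two kinds of mixture. Mixing it half and half with the greedy kernel
forces X ≤ 5q/2. Mixing the greedy kernel with weight p of c gives gap estimate at most p(Δ + 4q) +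
(1 - p)q and information at least p I(c). For a suitable p this bounds the cube of the expected gap
of the round by 256 αβΔI (`cube_le_of_ratio_bounds`, `IsContextualIDS.lintegral_gap_cube_le`).

The confidence set fails with probability at most 1/(t+1)², by the method of mixtures: an
exponential supermartingale in each direction, a Gaussian average over directions, and Markov's
inequality. These rounds cost at most 2Δ in total. In the others β is monotone along the history,
Hölder's inequality with three exponents 1/3 separates the expectations of β and of the information,
and concavity of the cube root over n rounds gives n^(2/3). Finally Δ ≤ B turns 256Δ into 54(Δ +
4B). -/

theorem measurableSet_exists_mem_le {S : X → Set A} (hS : ∀ x, IsClosed (S x))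
    (hSm : ∀ F, IsClosed F → MeasurableSet {x | (S x ∩ F).Nonempty}) {f : X → A → ℝ}
    (hc : ∀ x, Continuous (f x)) (hm : ∀ a, Measurable fun x => f x a) (r : ℝ) :
    MeasurableSet {x | ∃ a ∈ S x, f x a ≤ r} := by
  let := TopologicalSpace.metrizableSpaceMetric A
  obtain ⟨g, hg⟩ := TopologicalSpace.exists_dense_seq C(A, ℝ)
  obtain ⟨D, hDc, hD⟩ := TopologicalSpace.exists_countable_dense A
  have hnear : ∀ (i : ℕ) (e : ℝ), MeasurableSet {x | ∀ a, |f x a - g i a| ≤ e} := by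
    intro i e
    have : {x | ∀ a, |f x a - g i a| ≤ e} = ⋂ a ∈ D, {x | |f x a - g i a| ≤ e} := by
      ext x
      simp only [Set.mem_ofPred_eq, Set.mem_iInter]
      refine ⟨fun h a _ => h a, fun h a => ?_⟩
      have hcl : IsClosed {a | |f x a - g i a| ≤ e} :=
        isClosed_le (((hc x).sub (g i).continuous).abs) continuous_const
      have hsub : closure D ⊆ {a | |f x a - g i a| ≤ e} :=
        hcl.closure_subset_iff.2 fun a ha => h a ha
      exact hsub (hD a)
    rw [this]
    exact MeasurableSet.biInter hDc fun a _ =>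
      measurableSet_le (((hm a).sub_const _).abs) measurable_const
  -- Replacing `f x` by a uniformly close member of a countable dense family in C(A, ℝ) makes the
  -- sublevel set independent of x, so that only fixed closed sets are tested against `S`.
  -- Compactness recovers an exact point from the approximate ones.
  have hset : {x | ∃ a ∈ S x, f x a ≤ r} = ⋂ n : ℕ, ⋃ i : ℕ,
      {x | ∀ a, |f x a - g i a| ≤ 1 / ((n : ℝ) + 1)} ∩
        {x | (S x ∩ {a | g i a ≤ r + 1 / ((n : ℝ) + 1)}).Nonempty} := by
    ext x
    simp only [Set.mem_ofPred_eq, Set.mem_iInter, Set.mem_iUnion, Set.mem_inter_iff]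
    constructor
    · rintro ⟨a, ha, har⟩ n
      have hpos : (0 : ℝ) < 1 / ((n : ℝ) + 1) := by positivity
      obtain ⟨i, hi⟩ := hg.exists_dist_lt ⟨f x, hc x⟩ hpos
      have hd : ∀ b, |f x b - g i b| ≤ 1 / ((n : ℝ) + 1) := fun b =>
        (ContinuousMap.dist_apply_le_dist (f := ⟨f x, hc x⟩) (g := g i) b).trans hi.le
      refine ⟨i, hd, a, ha, ?_⟩
      have := (abs_le.1 (hd a)).1
      show g i a ≤ _
      linarith
    · intro h
      choose i hi b hb using h
      obtain ⟨a, ha, φ, hφ, hlim⟩ := (hS x).isCompact.tendsto_subseq fun n => (hb n).1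
      refine ⟨a, ha, ?_⟩
      have h1 : Filter.Tendsto (fun n => f x (b (φ n))) Filter.atTop (nhds (f x a)) :=
        ((hc x).tendsto a).comp hlim
      have h2 : Filter.Tendsto (fun n => r + 2 * (1 / ((φ n : ℝ) + 1))) Filter.atTop
          (nhds (r + 2 * 0)) :=
        ((tendsto_one_div_add_atTop_nhds_zero_nat.comp hφ.tendsto_atTop).const_mul 2).const_add r
      have h3 : f x a ≤ r + 2 * 0 := by
        refine le_of_tendsto_of_tendsto' h1 h2 fun n => ?_
        have e1 := (abs_le.1 (hi (φ n) (b (φ n)))).2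
        have e2 : g (i (φ n)) (b (φ n)) ≤ r + 1 / ((φ n : ℝ) + 1) := (hb (φ n)).2
        linarith
      simpa using h3
  rw [hset]
  exact MeasurableSet.iInter fun n => MeasurableSet.iUnion fun i =>
    (hnear i _).inter (hSm _ (isClosed_le (g i).continuous continuous_const))

/-- The minimum of a Carathéodory function over a measurable compact-valued correspondence. -/
theorem exists_measurable_min {S : X → Set A} (hS : ∀ x, IsClosed (S x))
    (hne : ∀ x, (S x).Nonempty)
    (hSm : ∀ F, IsClosed F → MeasurableSet {x | (S x ∩ F).Nonempty}) {f : X → A → ℝ}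
    (hc : ∀ x, Continuous (f x)) (hm : ∀ a, Measurable fun x => f x a) :
    ∃ μ : X → ℝ, Measurable μ ∧ (∀ x, ∀ a ∈ S x, μ x ≤ f x a) ∧ ∀ x, ∃ a ∈ S x, f x a = μ x := by
  choose a ha hmin using fun x => (hS x).isCompact.exists_isMinOn (hne x) (hc x).continuousOn
  refine ⟨fun x => f x (a x), measurable_of_Iic fun r => ?_, fun x b hb => hmin x hb,
    fun x => ⟨a x, ha x, rfl⟩⟩
  have : (fun x => f x (a x)) ⁻¹' Set.Iic r = {x | ∃ a ∈ S x, f x a ≤ r} := by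
    ext x
    exact ⟨fun h => ⟨a x, ha x, h⟩, fun ⟨b, hb, h⟩ => (hmin x hb : f x (a x) ≤ f x b).trans h⟩
  rw [this]
  exact measurableSet_exists_mem_le hS hSm hc hm r

/-- Absorbing `F` into the correspondence and `μ` into the integrand reduces this to a sublevel
statement at level 0. It keeps argmin correspondences measurable, so that selections can be taken
from them. -/
theorem measurableSet_argmin_inter {S : X → Set A} (hS : ∀ x, IsClosed (S x))
    (hSm : ∀ F, IsClosed F → MeasurableSet {x | (S x ∩ F).Nonempty}) {f : X → A → ℝ}
    (hc : ∀ x, Continuous (f x)) (hm : ∀ a, Measurable fun x => f x a) {μ : X → ℝ}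
    (hμ : Measurable μ) (F : Set A) (hF : IsClosed F) :
    MeasurableSet {x | ((S x ∩ {a | f x a ≤ μ x}) ∩ F).Nonempty} := by
  have := measurableSet_exists_mem_le (S := fun x => S x ∩ F) (f := fun x a => f x a - μ x)
    (fun x => (hS x).inter hF)
    (fun F' hF' => by simpa only [Set.inter_assoc] using hSm _ (hF.inter hF'))
    (fun x => (hc x).sub continuous_const) (fun a => (hm a).sub hμ) 0
  convert this using 1
  ext x
  constructor
  · rintro ⟨a, ⟨h1, h2⟩, h3⟩
    exact ⟨a, ⟨h1, h3⟩, sub_nonpos.2 h2⟩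
  · rintro ⟨a, ⟨h1, h3⟩, h2⟩
    exact ⟨a, ⟨h1, sub_nonpos.1 h2⟩, h3⟩

/-- A measurable compact-valued correspondence has a measurable selection: take the minimiser of the
distances to a dense sequence in the lexicographic order. -/
theorem exists_measurable_selection [MeasurableSpace A] [BorelSpace A] {S : X → Set A}
    (hS : ∀ x, IsClosed (S x)) (hne : ∀ x, (S x).Nonempty)
    (hSm : ∀ F, IsClosed F → MeasurableSet {x | (S x ∩ F).Nonempty}) :
    ∃ c : X → A, Measurable c ∧ ∀ x, c x ∈ S x := by
  let := TopologicalSpace.metrizableSpaceMetric A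
  rcases isEmpty_or_nonempty X with hX | ⟨⟨x₀⟩⟩
  · exact ⟨fun x => hX.elim x, measurable_of_empty _, fun x => hX.elim x⟩
  have : Nonempty A := ⟨(hne x₀).some⟩
  let P : (X → Set A) → Prop := fun S => (∀ x, IsClosed (S x)) ∧ (∀ x, (S x).Nonempty) ∧
    ∀ F, IsClosed F → MeasurableSet {x | (S x ∩ F).Nonempty}
  let p := TopologicalSpace.denseSeq A
  -- One refinement: keep the points nearest to `p k`, so that the distance to `p k` is constant on
  -- what remains.
  have step : ∀ (T : {S // P S}) (k : ℕ), ∃ (T' : {S // P S}) (μ : X → ℝ), Measurable μ ∧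
      (∀ x, T'.1 x ⊆ T.1 x) ∧ ∀ x, ∀ a ∈ T'.1 x, dist a (p k) = μ x := by
    rintro ⟨T, h1, h2, h3⟩ k
    have hc : ∀ _ : X, Continuous fun a => dist a (p k) := fun _ => by fun_prop
    obtain ⟨μ, hμ, hle, hex⟩ := exists_measurable_min h1 h2 h3 (f := fun _ a => dist a (p k)) hc
      (fun _ => measurable_const)
    refine ⟨⟨fun x => T x ∩ {a | dist a (p k) ≤ μ x}, fun x => ?_, fun x => ?_, fun F hF => ?_⟩,
      μ, hμ, fun x => Set.inter_subset_left, fun x a ha => le_antisymm ha.2 (hle x a ha.1)⟩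
    · exact (h1 x).inter (isClosed_le (hc x) continuous_const)
    · obtain ⟨a, ha, he⟩ := hex x
      exact ⟨a, ha, he.le⟩
    · exact measurableSet_argmin_inter h1 h3 hc (fun _ => measurable_const) hμ F hF
  choose next μ hμ hsub heq using step
  let T : ℕ → {S // P S} := fun k => Nat.rec ⟨S, hS, hne, hSm⟩ (fun k T => next T k) k
  have hT : ∀ k, T (k + 1) = next (T k) k := fun k => rfl
  have hanti : ∀ x k, (T (k + 1)).1 x ⊆ (T k).1 x := fun x k => by rw [hT]; exact hsub _ _ x
  have hint : ∀ x, (⋂ k, (T k).1 x).Nonempty := fun x =>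
    IsCompact.nonempty_iInter_of_sequence_nonempty_isCompact_isClosed _ (hanti x)
      (fun k => (T k).2.2.1 x) ((T 0).2.1 x).isCompact (fun k => (T k).2.1 x)
  choose c hc using hint
  rw [forall_congr' fun x => Set.mem_iInter] at hc
  have hdist : ∀ k x, dist (c x) (p k) = μ (T k) k x := fun k x =>
    heq (T k) k x (c x) (by rw [← hT]; exact hc x (k + 1))
  refine ⟨c, ?_, fun x => hc x 0⟩
  refine measurable_of_isClosed fun F hF => ?_
  -- If every refinement meets `F`, compactness gives a common point in `F`. It has the same
  -- distances to the dense sequence as `c x`, hence equals `c x`.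
  have hpre : c ⁻¹' F = ⋂ k, {x | ((T k).1 x ∩ F).Nonempty} := by
    ext x
    rw [Set.mem_iInter]
    refine ⟨fun h k => ⟨c x, hc x k, h⟩, fun h => ?_⟩
    obtain ⟨a, ha⟩ := IsCompact.nonempty_iInter_of_sequence_nonempty_isCompact_isClosed
      (fun k => (T k).1 x ∩ F) (fun k => Set.inter_subset_inter_left F (hanti x k)) h
      (((T 0).2.1 x).inter hF).isCompact (fun k => ((T k).2.1 x).inter hF)
    rw [Set.mem_iInter] at ha
    have hk : ∀ k, dist a (p k) = dist (c x) (p k) := fun k => by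
      rw [hdist, heq (T k) k x a (by rw [← hT]; exact (ha (k + 1)).1)]
    have hall : (fun q => dist a q) = fun q => dist (c x) q :=
      (TopologicalSpace.denseRange_denseSeq A).equalizer (by fun_prop) (by fun_prop) (funext hk)
    have h0 := congrFun hall (c x)
    simp only [dist_self, dist_eq_zero] at h0
    rw [Set.mem_preimage, ← h0]
    exact (ha 0).2
  rw [hpre]
  exact MeasurableSet.iInter fun k => (T k).2.2.2 F hF

/-- The measurable maximum theorem for Carathéodory functions. -/
theorem exists_measurable_argmax [MeasurableSpace A] [BorelSpace A] {S : X → Set A}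
    (hS : ∀ x, IsClosed (S x)) (hne : ∀ x, (S x).Nonempty)
    (hSm : ∀ F, IsClosed F → MeasurableSet {x | (S x ∩ F).Nonempty}) {f : X → A → ℝ}
    (hc : ∀ x, Continuous (f x)) (hm : ∀ a, Measurable fun x => f x a) :
    ∃ c : X → A, Measurable c ∧ ∀ x, c x ∈ S x ∧ ∀ a ∈ S x, f x a ≤ f x (c x) := by
  have hc' : ∀ x, Continuous fun a => -f x a := fun x => (hc x).neg
  have hm' : ∀ a, Measurable fun x => -f x a := fun a => (hm a).neg
  obtain ⟨μ, hμ, hle, hex⟩ := exists_measurable_min hS hne hSm hc' hm'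
  obtain ⟨c, hcm, hcS⟩ := exists_measurable_selection
    (S := fun x => S x ∩ {a | -f x a ≤ μ x})
    (fun x => (hS x).inter (isClosed_le (hc' x) continuous_const))
    (fun x => (hex x).imp fun a ha => ⟨ha.1, ha.2.le⟩)
    (measurableSet_argmin_inter hS hSm hc' hm' hμ)
  refine ⟨c, hcm, fun x => ⟨(hcS x).1, fun a ha => ?_⟩⟩
  have h1 : -f x (c x) ≤ μ x := (hcS x).2
  have h2 := hle x a ha
  linarith

end Selection

/-! ### Matrices acting on Euclidean spaces -/

section LinearAlgebra

open scoped Matrix MatrixOrder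

variable {j k l d m : ℕ}

/-- The matrix-vector product as a continuous linear map. -/
def appL (M : Matrix (Fin l) (Fin k) ℝ) : Vec k →L[ℝ] Vec l :=
  LinearMap.toContinuousLinearMap
    { toFun := app M
      map_add' := fun v w => by simp [app, Matrix.mulVec_add]
      map_smul' := fun c v => by simp [app, Matrix.mulVec_smul] }

@[simp] theorem appL_apply (M : Matrix (Fin l) (Fin k) ℝ) (v : Vec k) : appL M v = app M v := rfl

theorem app_add (M : Matrix (Fin l) (Fin k) ℝ) (v w : Vec k) :
    app M (v + w) = app M v + app M w := (appL M).map_add v w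

theorem app_sub (M : Matrix (Fin l) (Fin k) ℝ) (v w : Vec k) :
    app M (v - w) = app M v - app M w := (appL M).map_sub v w

theorem app_smul (M : Matrix (Fin l) (Fin k) ℝ) (c : ℝ) (v : Vec k) :
    app M (c • v) = c • app M v := (appL M).map_smul c v

@[simp] theorem app_zero (M : Matrix (Fin l) (Fin k) ℝ) : app M 0 = 0 := (appL M).map_zero

theorem app_mul (M : Matrix (Fin l) (Fin k) ℝ) (N : Matrix (Fin k) (Fin j) ℝ) (v : Vec j) :
    app (M * N) v = app M (app N v) := by
  simp [app, Matrix.mulVec_mulVec]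

@[simp] theorem app_one (v : Vec k) : app 1 v = v := by
  simp [app]

theorem app_matrix_add (M N : Matrix (Fin l) (Fin k) ℝ) (v : Vec k) :
    app (M + N) v = app M v + app N v := by
  simp [app, Matrix.add_mulVec]

theorem app_matrix_smul (c : ℝ) (M : Matrix (Fin l) (Fin k) ℝ) (v : Vec k) :
    app (c • M) v = c • app M v := by
  simp [app, Matrix.smul_mulVec]

theorem app_matrix_sum {ι : Type*} (s : Finset ι) (M : ι → Matrix (Fin l) (Fin k) ℝ) (v : Vec k) :
    app (∑ i ∈ s, M i) v = ∑ i ∈ s, app (M i) v := by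
  simp [app, Matrix.sum_mulVec]

theorem inner_eq_dotProduct (v w : Vec k) : inner ℝ v w = v.ofLp ⬝ᵥ w.ofLp := by
  rw [EuclideanSpace.inner_eq_star_dotProduct, dotProduct_comm]
  simp

theorem inner_app_left (M : Matrix (Fin l) (Fin k) ℝ) (v : Vec k) (w : Vec l) :
    inner ℝ (app M v) w = inner ℝ v (app M.transpose w) := by
  rw [inner_eq_dotProduct, inner_eq_dotProduct]
  simp only [app]
  rw [Matrix.mulVec_transpose, dotProduct_comm v.ofLp, ← Matrix.dotProduct_mulVec, dotProduct_comm]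

theorem inner_app_right (M : Matrix (Fin l) (Fin k) ℝ) (v : Vec l) (w : Vec k) :
    inner ℝ v (app M w) = inner ℝ (app M.transpose v) w := by
  rw [inner_app_left, Matrix.transpose_transpose]

theorem norm_app_sq (M : Matrix (Fin l) (Fin k) ℝ) (v : Vec k) :
    ‖app M v‖ ^ 2 = inner ℝ v (app (M.transpose * M) v) := by
  rw [← real_inner_self_eq_norm_sq, inner_app_left, app_mul]

/-- With such an R the V-norm of w is ‖Rw‖ and the V⁻¹-norm of v is ‖R⁻ᵀv‖. All weighted norms below
are written in this form. -/
theorem exists_transpose_mul_self {V : Matrix (Fin d) (Fin d) ℝ} (hV : V.PosDef) :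
    ∃ R : Matrix (Fin d) (Fin d) ℝ, V = R.transpose * R ∧ IsUnit R.det := by
  obtain ⟨R, hR⟩ := CStarAlgebra.nonneg_iff_eq_star_mul_self.mp hV.posSemidef.nonneg
  rw [Matrix.star_eq_conjTranspose, Matrix.conjTranspose_eq_transpose_of_trivial] at hR
  refine ⟨R, hR, isUnit_iff_ne_zero.2 fun h => ?_⟩
  have := hV.det_pos
  rw [hR, Matrix.det_mul, h, mul_zero] at this
  exact this.false

/-! ### The norms of V and V⁻¹ through a factorisation V = RᵀR -/

section Factor

variable {V R : Matrix (Fin d) (Fin d) ℝ} (hVR : V = R.transpose * R) (hR : IsUnit R.det)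

include hVR in
theorem norm_app_factor_sq (w : Vec d) : ‖app R w‖ ^ 2 = inner ℝ w (app V w) := by
  rw [norm_app_sq, hVR]

include hR in
theorem app_factor_inv (w : Vec d) : app R (app R⁻¹ w) = w := by
  rw [← app_mul, Matrix.mul_nonsing_inv _ hR, app_one]

include hR in
theorem app_inv_factor (w : Vec d) : app R⁻¹ (app R w) = w := by
  rw [← app_mul, Matrix.nonsing_inv_mul _ hR, app_one]

include hVR in
theorem inv_eq_factor : V⁻¹ = R⁻¹ * R⁻¹.transpose := by
  rw [hVR, Matrix.mul_inv_rev, Matrix.transpose_nonsing_inv]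

include hVR in
theorem norm_app_factor_inv_sq (v : Vec d) :
    ‖app R⁻¹.transpose v‖ ^ 2 = inner ℝ v (app V⁻¹ v) := by
  rw [norm_app_sq, inv_eq_factor hVR, Matrix.transpose_transpose]

include hR in
theorem inner_eq_inner_factor (v w : Vec d) :
    inner ℝ v w = inner ℝ (app R⁻¹.transpose v) (app R w) := by
  rw [inner_app_left, Matrix.transpose_transpose, app_inv_factor hR]

include hR in
theorem inner_le_norm_factor (v w : Vec d) :
    inner ℝ v w ≤ ‖app R⁻¹.transpose v‖ * ‖app R w‖ := by
  rw [inner_eq_inner_factor hR]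
  exact real_inner_le_norm _ _

include hR in
-- Dual to V ≥ λ: with T = R⁻ᵀv one has ‖T‖² = ⟨v, R⁻¹T⟩ ≤ ‖v‖‖R⁻¹T‖, and √λ‖R⁻¹T‖ ≤ ‖T‖.
theorem sqrt_mul_norm_factor_inv_le {lam : ℝ}
    (hlam : ∀ w, lam * ‖w‖ ^ 2 ≤ ‖app R w‖ ^ 2) (v : Vec d) :
    √lam * ‖app R⁻¹.transpose v‖ ≤ ‖v‖ := by
  set T := app R⁻¹.transpose v
  have h1 : ‖T‖ ^ 2 = inner ℝ v (app R⁻¹ T) := by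
    rw [← real_inner_self_eq_norm_sq]
    conv_lhs => rw [show T = app R⁻¹.transpose v from rfl]
    rw [inner_app_left, Matrix.transpose_transpose]
  have h2 : √lam * ‖app R⁻¹ T‖ ≤ ‖T‖ := by
    have := hlam (app R⁻¹ T)
    rw [app_factor_inv hR] at this
    have h3 := Real.sqrt_le_sqrt this
    rwa [Real.sqrt_mul' _ (sq_nonneg _), Real.sqrt_sq (norm_nonneg _),
      Real.sqrt_sq (norm_nonneg _)] at h3
  have h3 : ‖T‖ ^ 2 ≤ ‖v‖ * ‖app R⁻¹ T‖ := h1 ▸ real_inner_le_norm _ _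
  by_contra! hlt
  have hT : 0 < ‖T‖ := by
    by_contra! h0
    have : ‖T‖ = 0 := le_antisymm h0 (norm_nonneg _)
    rw [this, mul_zero] at hlt
    exact absurd hlt (not_lt.2 (norm_nonneg _))
  have : √lam * ‖T‖ ^ 2 ≤ ‖v‖ * ‖T‖ := by
    calc √lam * ‖T‖ ^ 2 ≤ √lam * (‖v‖ * ‖app R⁻¹ T‖) := by gcongr
      _ = ‖v‖ * (√lam * ‖app R⁻¹ T‖) := by ring
      _ ≤ ‖v‖ * ‖T‖ := by gcongr
  nlinarith

end Factor

/-! ### Determinants of `1 + N Nᵀ` -/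

theorem trace_transpose_mul_self (N : Matrix (Fin m) (Fin d) ℝ) :
    (N.transpose * N).trace = ∑ i, ‖app N (EuclideanSpace.single i 1)‖ ^ 2 := by
  refine Finset.sum_congr rfl fun i _ => ?_
  rw [norm_app_sq, inner_eq_dotProduct]
  simp [app]

/-- The operator norm is at most the Hilbert–Schmidt norm, by Cauchy–Schwarz over the coordinates.
-/
theorem norm_app_sq_le_trace (N : Matrix (Fin m) (Fin d) ℝ) (x : Vec d) :
    ‖app N x‖ ^ 2 ≤ (N.transpose * N).trace * ‖x‖ ^ 2 := by
  have hx : x = ∑ i, x i • EuclideanSpace.single i (1 : ℝ) := by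
    ext i
    simp [Finset.sum_apply, Pi.single_apply]
  have h1 : ‖app N x‖ ≤ ∑ i, ‖app N (EuclideanSpace.single i 1)‖ * |x i| := by
    conv_lhs => rw [hx, ← appL_apply, map_sum]
    refine (norm_sum_le _ _).trans (Finset.sum_le_sum fun i _ => ?_)
    rw [map_smul, norm_smul, Real.norm_eq_abs, mul_comm, appL_apply]
  calc ‖app N x‖ ^ 2 ≤ (∑ i, ‖app N (EuclideanSpace.single i 1)‖ * |x i|) ^ 2 := by gcongr
    _ ≤ (∑ i, ‖app N (EuclideanSpace.single i 1)‖ ^ 2) * ∑ i, |x i| ^ 2 :=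
      Finset.sum_mul_sq_le_sq_mul_sq _ _ _
    _ = _ := by
      rw [trace_transpose_mul_self, EuclideanSpace.norm_sq_eq]
      simp

theorem posDef_one_add (N : Matrix (Fin m) (Fin d) ℝ) : (1 + N.transpose * N).PosDef := by
  have := Matrix.posSemidef_conjTranspose_mul_self N
  rw [Matrix.conjTranspose_eq_transpose_of_trivial] at this
  exact Matrix.PosDef.one.add_posSemidef this

theorem one_le_eigenvalues (N : Matrix (Fin m) (Fin d) ℝ) (i : Fin d) :
    1 ≤ (posDef_one_add N).isHermitian.eigenvalues i := by
  set hH := (posDef_one_add N).isHermitian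
  let e := hH.eigenvectorBasis i
  have h1 : inner ℝ e (app (1 + N.transpose * N) e) = hH.eigenvalues i := by
    have : app (1 + N.transpose * N) e = hH.eigenvalues i • e := by
      have := hH.mulVec_eigenvectorBasis i
      simp only [app, e, this]
      rfl
    rw [this, inner_smul_right, real_inner_self_eq_norm_sq, hH.eigenvectorBasis.norm_eq_one i]
    simp
  rw [app_matrix_add, app_one, inner_add_right, ← norm_app_sq, real_inner_self_eq_norm_sq,
    hH.eigenvectorBasis.norm_eq_one i] at h1
  nlinarith [sq_nonneg ‖app N e‖]

theorem sum_eigenvalues (N : Matrix (Fin m) (Fin d) ℝ) :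
    ∑ i, ((posDef_one_add N).isHermitian.eigenvalues i - 1) = (N.transpose * N).trace := by
  have h := (posDef_one_add N).isHermitian.trace_eq_sum_eigenvalues
  rw [Matrix.trace_add, Matrix.trace_one] at h
  rw [Finset.sum_sub_distrib]
  simp at h ⊢
  linarith

theorem det_one_add_eq (N : Matrix (Fin m) (Fin d) ℝ) :
    (1 + N * N.transpose).det = ∏ i, (posDef_one_add N).isHermitian.eigenvalues i := by
  rw [Matrix.det_one_add_mul_comm, (posDef_one_add N).isHermitian.det_eq_prod_eigenvalues]
  rfl

/-- The eigenvalues of 1 + NᵀN have the form 1 + xᵢ with xᵢ ≥ 0, and ∏(1 + xᵢ) ≥ 1 + ∑xᵢ. -/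
theorem one_add_trace_le_det (N : Matrix (Fin m) (Fin d) ℝ) :
    1 + (N.transpose * N).trace ≤ (1 + N * N.transpose).det := by
  have key : ∀ (s : Finset (Fin d)) (x : Fin d → ℝ), (∀ i, 0 ≤ x i) →
      1 + ∑ i ∈ s, x i ≤ ∏ i ∈ s, (1 + x i) := by
    intro s x hx
    induction s using Finset.cons_induction with
    | empty => simp
    | cons i s hi ih =>
      rw [Finset.sum_cons, Finset.prod_cons]
      have := Finset.sum_nonneg fun i (_ : i ∈ s) => hx i
      nlinarith [hx i, mul_nonneg (hx i) this]
  have := key Finset.univ (fun i => (posDef_one_add N).isHermitian.eigenvalues i - 1)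
    fun i => sub_nonneg.2 (one_le_eigenvalues N i)
  rw [sum_eigenvalues] at this
  simpa [det_one_add_eq] using this

theorem det_le_exp_trace (N : Matrix (Fin m) (Fin d) ℝ) :
    (1 + N * N.transpose).det ≤ Real.exp (N.transpose * N).trace := by
  rw [← sum_eigenvalues, Real.exp_sum, det_one_add_eq]
  refine Finset.prod_le_prod (fun i _ => zero_le_one.trans (one_le_eigenvalues N i)) fun i _ => ?_
  have := Real.add_one_le_exp ((posDef_one_add N).isHermitian.eigenvalues i - 1)
  linarith

theorem trace_transpose_mul_self_nonneg (N : Matrix (Fin m) (Fin d) ℝ) :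
    0 ≤ (N.transpose * N).trace := by
  rw [trace_transpose_mul_self]
  positivity

theorem log_det_one_add_le (N : Matrix (Fin m) (Fin d) ℝ) :
    Real.log (1 + N * N.transpose).det ≤ (N.transpose * N).trace := by
  have h1 := one_add_trace_le_det N
  have h2 := trace_transpose_mul_self_nonneg N
  rw [Real.log_le_iff_le_exp (by linarith)]
  exact det_le_exp_trace N

theorem log_det_one_add_nonneg (N : Matrix (Fin m) (Fin d) ℝ) :
    0 ≤ Real.log (1 + N * N.transpose).det := by
  have h1 := one_add_trace_le_det N
  have h2 := trace_transpose_mul_self_nonneg N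
  exact Real.log_nonneg (by linarith)

/-- A lower bound on the information in a direction. -/
theorem norm_app_sq_le_log_det (N : Matrix (Fin m) (Fin d) ℝ) {x : Vec d} (hx : ‖x‖ ≤ 1)
    (hN : ‖app N x‖ ≤ 1) : ‖app N x‖ ^ 2 ≤ 2 * Real.log (1 + N * N.transpose).det := by
  have h2 := trace_transpose_mul_self_nonneg N
  have h3 : ‖app N x‖ ^ 2 ≤ (N.transpose * N).trace :=
    (norm_app_sq_le_trace N x).trans (mul_le_of_le_one_right h2 (pow_le_one₀ (norm_nonneg _) hx))
  have h4 : 1 + ‖app N x‖ ^ 2 ≤ (1 + N * N.transpose).det := by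
    linarith [one_add_trace_le_det N]
  have h0 : 0 ≤ ‖app N x‖ ^ 2 := by positivity
  have h5 : ‖app N x‖ ^ 2 ≤ 1 := pow_le_one₀ (norm_nonneg _) hN
  have h6 := Real.log_le_log (by linarith) h4
  have h7 := Real.one_sub_inv_le_log_of_pos (x := 1 + ‖app N x‖ ^ 2) (by linarith)
  -- The factor 2: for 0 ≤ s ≤ 1, s/2 ≤ s/(1 + s) = 1 - 1/(1 + s) ≤ log(1 + s).
  have h8 : ‖app N x‖ ^ 2 / 2 ≤ 1 - (1 + ‖app N x‖ ^ 2)⁻¹ := by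
    rw [le_sub_iff_add_le, ← le_sub_iff_add_le', inv_le_iff_one_le_mul₀ (by linarith)]
    nlinarith
  linarith

end LinearAlgebra

namespace ContextualGame

variable {Z A : Type*} [MeasurableSpace Z] [TopologicalSpace A] {d m : ℕ}

/-! ### The Gram matrix and the information gain -/

section Gram

variable (G : ContextualGame Z A d m) {lam : ℝ} {t : ℕ} (h : History Z A m t)

theorem inner_app_gram (w : Vec d) :
    inner ℝ w (app (G.gram lam h) w) =
      lam * ‖w‖ ^ 2 + ∑ s, ‖app (G.obs (h s).1 (h s).2.1) w‖ ^ 2 := by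
  rw [gram, app_matrix_add, app_matrix_smul, app_one, app_matrix_sum, inner_add_right,
    inner_smul_right, real_inner_self_eq_norm_sq, inner_sum]
  simp only [norm_app_sq]

theorem gram_posDef (hlam : 0 < lam) : (G.gram lam h).PosDef := by
  refine Matrix.PosDef.add_posSemidef (Matrix.PosDef.one.smul hlam)
    (Matrix.posSemidef_sum _ fun s _ => ?_)
  have := Matrix.posSemidef_conjTranspose_mul_self (G.obs (h s).1 (h s).2.1)
  rwa [Matrix.conjTranspose_eq_transpose_of_trivial] at this

theorem mul_norm_sq_le_factor {R : Matrix (Fin d) (Fin d) ℝ}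
    (hVR : G.gram lam h = R.transpose * R) (w : Vec d) : lam * ‖w‖ ^ 2 ≤ ‖app R w‖ ^ 2 := by
  rw [norm_app_factor_sq hVR, inner_app_gram]
  have : 0 ≤ ∑ s, ‖app (G.obs (h s).1 (h s).2.1) w‖ ^ 2 := by positivity
  linarith

theorem infoGain_eq_factor {R : Matrix (Fin d) (Fin d) ℝ} (hVR : G.gram lam h = R.transpose * R)
    (a : A) (z : Z) : G.infoGain lam h a z = 1 / 2 * Real.log
      (1 + (G.obs z a * R⁻¹) * (G.obs z a * R⁻¹).transpose : Matrix (Fin m) (Fin m) ℝ).det := by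
  rw [infoGain, inv_eq_factor hVR, Matrix.transpose_mul]
  simp only [Matrix.mul_assoc]

theorem infoGain_nonneg (hlam : 0 < lam) (a : A) (z : Z) : 0 ≤ G.infoGain lam h a z := by
  obtain ⟨R, hVR, -⟩ := exists_transpose_mul_self (G.gram_posDef h hlam)
  rw [G.infoGain_eq_factor h hVR]
  have := log_det_one_add_nonneg (G.obs z a * R⁻¹)
  positivity

theorem norm_app_obs_le_factor {R : Matrix (Fin d) (Fin d) ℝ}
    (hVR : G.gram lam h = R.transpose * R) {L : ℝ}
    (hL : L ^ 2 ≤ lam) {z : Z} {a : A} (ha : ∀ v, ‖app (G.obs z a) v‖ ≤ L * ‖v‖) (w : Vec d) :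
    ‖app (G.obs z a) w‖ ≤ ‖app R w‖ := by
  refine le_of_sq_le_sq ?_ (norm_nonneg _)
  calc ‖app (G.obs z a) w‖ ^ 2 ≤ (L * ‖w‖) ^ 2 := by gcongr; exact ha w
    _ = L ^ 2 * ‖w‖ ^ 2 := by ring
    _ ≤ lam * ‖w‖ ^ 2 := by gcongr
    _ ≤ _ := G.mul_norm_sq_le_factor h hVR w

/-- Since L² ≤ λ, the matrix MR⁻¹ is a contraction, so its squared Hilbert–Schmidt norm is at most
d. This boundedness makes the information and β integrable. -/
theorem infoGain_le (hlam : 0 < lam) {L : ℝ}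
    (hL : L ^ 2 ≤ lam) {z : Z} {a : A} (ha : ∀ v, ‖app (G.obs z a) v‖ ≤ L * ‖v‖) :
    G.infoGain lam h a z ≤ d / 2 := by
  obtain ⟨R, hVR, hR⟩ := exists_transpose_mul_self (G.gram_posDef h hlam)
  rw [G.infoGain_eq_factor h hVR]
  have h1 := log_det_one_add_le (G.obs z a * R⁻¹)
  have h2 : ((G.obs z a * R⁻¹).transpose * (G.obs z a * R⁻¹)).trace ≤ d := by
    rw [trace_transpose_mul_self]
    refine (Finset.sum_le_card_nsmul _ _ 1 fun i _ => ?_).trans (by simp)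
    refine pow_le_one₀ (norm_nonneg _) ?_
    rw [app_mul]
    refine (G.norm_app_obs_le_factor h hVR hL ha _).trans ?_
    rw [app_factor_inv hR]
    simp
  linarith

/-- Converts the denominator of the alignment constant into information, uniformly over the V-unit
ball. The 4 is the 2 of the logarithmic bound times the ½ in the definition of the information gain.
-/
theorem norm_app_sq_le_infoGain {R : Matrix (Fin d) (Fin d) ℝ}
    (hVR : G.gram lam h = R.transpose * R) (hR : IsUnit R.det) {L : ℝ}
    (hL : L ^ 2 ≤ lam) {z : Z} {a : A} (ha : ∀ v, ‖app (G.obs z a) v‖ ≤ L * ‖v‖)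
    {w : Vec d} (hw : ‖app R w‖ ≤ 1) :
    ‖app (G.obs z a) w‖ ^ 2 ≤ 4 * G.infoGain lam h a z := by
  rw [G.infoGain_eq_factor h hVR]
  have h1 : app (G.obs z a * R⁻¹) (app R w) = app (G.obs z a) w := by
    rw [app_mul, app_inv_factor hR]
  have := norm_app_sq_le_log_det (G.obs z a * R⁻¹) hw (by
    rw [h1]; exact (G.norm_app_obs_le_factor h hVR hL ha w).trans hw)
  rw [h1] at this
  linarith

variable {Ω : Type*} {z : ℕ → Ω → Z} {a : ℕ → Ω → A} {y : ℕ → Ω → Vec m}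

theorem gram_hist_succ (t : ℕ) (o : Ω) : G.gram lam (hist z a y (t + 1) o) =
    G.gram lam (hist z a y t o) + (G.obs (z t o) (a t o)).transpose * G.obs (z t o) (a t o) := by
  simp only [gram, hist, Fin.sum_univ_castSucc, Fin.val_castSucc, Fin.val_last, add_assoc]

theorem log_det_gram_hist_succ (hlam : 0 < lam) (t : ℕ) (o : Ω) :
    Real.log (G.gram lam (hist z a y (t + 1) o)).det =
      Real.log (G.gram lam (hist z a y t o)).det +
        2 * G.infoGain lam (hist z a y t o) (a t o) (z t o) := by
  have hV := G.gram_posDef (hist z a y t o) hlam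
  obtain ⟨R, hVR, -⟩ := exists_transpose_mul_self hV
  have h1 := log_det_one_add_nonneg (G.obs (z t o) (a t o) * R⁻¹)
  have h2 := one_add_trace_le_det (G.obs (z t o) (a t o) * R⁻¹)
  have h3 := trace_transpose_mul_self_nonneg (G.obs (z t o) (a t o) * R⁻¹)
  rw [gram_hist_succ, Matrix.det_add_mul _ _ hV.det_pos.ne'.isUnit, infoGain, Real.log_mul
    hV.det_pos.ne']
  · ring
  · have h4 : 1 + G.obs (z t o) (a t o) * (G.gram lam (hist z a y t o))⁻¹ *
        (G.obs (z t o) (a t o)).transpose = 1 + (G.obs (z t o) (a t o) * R⁻¹) *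
          (G.obs (z t o) (a t o) * R⁻¹).transpose := by
      rw [inv_eq_factor hVR, Matrix.transpose_mul]
      simp only [Matrix.mul_assoc]
    rw [h4]
    linarith

/-- The matrix determinant lemma telescopes. The log-determinant difference inside β is therefore
twice the accumulated information, which makes β monotone along a history and bounded in each round.
-/
theorem log_det_gram_hist (hlam : 0 < lam) (t : ℕ) (o : Ω) :
    Real.log (G.gram lam (hist z a y t o)).det =
      Real.log (lam • (1 : Matrix (Fin d) (Fin d) ℝ)).det +
        2 * G.totalInfo lam z a y t o := by
  induction t with
  | zero => simp [gram, totalInfo]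
  | succ t ih =>
    rw [G.log_det_gram_hist_succ hlam, ih, totalInfo, totalInfo, Finset.sum_range_succ]
    ring

/-- The square root of the confidence coefficient. -/
def radius (lam B rho : ℝ) : ℝ :=
  rho * Real.sqrt (2 * Real.log (1 / (1 / ((t : ℝ) + 1) ^ 2)) + Real.log (G.gram lam h).det
      - Real.log (lam • (1 : Matrix (Fin d) (Fin d) ℝ)).det) + Real.sqrt lam * B

theorem beta_eq (lam B rho : ℝ) : G.beta lam B rho h = G.radius h lam B rho ^ 2 := rfl

theorem beta_nonneg (lam B rho : ℝ) : 0 ≤ G.beta lam B rho h := sq_nonneg _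

theorem radius_nonneg {B rho : ℝ} (hB : 0 ≤ B) (hrho : 0 ≤ rho) : 0 ≤ G.radius h lam B rho := by
  unfold radius
  positivity

theorem radius_hist_mono (hlam : 0 < lam) {B rho : ℝ} (hrho : 0 ≤ rho) {s t : ℕ}
    (hst : s ≤ t) (o : Ω) :
    G.radius (hist z a y s o) lam B rho ≤ G.radius (hist z a y t o) lam B rho := by
  have h1 : G.totalInfo lam z a y s o ≤ G.totalInfo lam z a y t o :=
    Finset.sum_le_sum_of_subset_of_nonneg (Finset.range_mono hst) fun i _ _ =>
      G.infoGain_nonneg _ hlam _ _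
  have h2 : Real.log (1 / (1 / ((s : ℝ) + 1) ^ 2)) ≤ Real.log (1 / (1 / ((t : ℝ) + 1) ^ 2)) := by
    rw [one_div_one_div, one_div_one_div]
    gcongr
  unfold radius
  rw [G.log_det_gram_hist hlam, G.log_det_gram_hist hlam]
  gcongr

theorem beta_hist_mono (hlam : 0 < lam) {B rho : ℝ} (hB : 0 ≤ B) (hrho : 0 ≤ rho) {s t : ℕ}
    (hst : s ≤ t) (o : Ω) :
    G.beta lam B rho (hist z a y s o) ≤ G.beta lam B rho (hist z a y t o) := by
  rw [beta_eq, beta_eq]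
  exact pow_le_pow_left₀ (G.radius_nonneg _ hB hrho) (G.radius_hist_mono hlam hrho hst o) 2

end Gram

/-! ### Measurability -/

section Measurability

variable (G : ContextualGame Z A d m) [CompactSpace A] [TopologicalSpace.MetrizableSpace A]
  [MeasurableSpace A] [BorelSpace A]

theorem measurable_feat : Measurable fun p : Z × A => G.feat p.1 p.2 := by
  have := measurable_uncurry_of_continuous_of_measurable (u := fun a z => G.feat z a)
    (fun z => G.feat_continuous z) G.feat_measurable
  exact this.comp measurable_swap

theorem measurable_obs (i : Fin m) (j : Fin d) : Measurable fun p : Z × A => G.obs p.1 p.2 i j := by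
  have := measurable_uncurry_of_continuous_of_measurable (u := fun a z => G.obs z a i j)
    (fun z => (G.obs_continuous z).matrix_elem i j) (fun a => G.obs_measurable a i j)
  exact this.comp measurable_swap

theorem measurable_det {X : Type*} [MeasurableSpace X] {k : ℕ} {M : X → Matrix (Fin k) (Fin k) ℝ}
    (hM : ∀ i j, Measurable fun x => M x i j) : Measurable fun x => (M x).det := by
  simp only [Matrix.det_apply']
  exact Finset.measurable_fun_sum _ fun σ _ =>
    (Finset.measurable_fun_prod _ fun i _ => hM _ _).const_mul _

theorem measurable_inv {X : Type*} [MeasurableSpace X] {k : ℕ} {M : X → Matrix (Fin k) (Fin k) ℝ}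
    (hM : ∀ i j, Measurable fun x => M x i j) (i j : Fin k) :
    Measurable fun x => (M x)⁻¹ i j := by
  simp only [Matrix.inv_def, Matrix.smul_apply, smul_eq_mul, Ring.inverse_eq_inv',
    Matrix.adjugate_apply]
  refine (measurable_det hM).inv.mul (measurable_det fun a b => ?_)
  simp only [Matrix.updateRow_apply]
  split_ifs
  · exact measurable_const
  · exact hM a b

theorem measurable_mul {X : Type*} [MeasurableSpace X] {j k l : ℕ}
    {M : X → Matrix (Fin j) (Fin k) ℝ} {N : X → Matrix (Fin k) (Fin l) ℝ}
    (hM : ∀ i j, Measurable fun x => M x i j) (hN : ∀ i j, Measurable fun x => N x i j)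
    (i : Fin j) (i' : Fin l) : Measurable fun x => (M x * N x) i i' := by
  simp only [Matrix.mul_apply]
  exact Finset.measurable_fun_sum _ fun σ _ => (hM _ _).mul (hN _ _)

theorem measurable_app {X : Type*} [MeasurableSpace X] {k l : ℕ}
    {M : X → Matrix (Fin l) (Fin k) ℝ} {v : X → Vec k}
    (hM : ∀ i j, Measurable fun x => M x i j) (hv : Measurable v) :
    Measurable fun x => app (M x) (v x) := by
  have hv' : Measurable fun x => (v x).ofLp := (WithLp.measurable_ofLp 2 _).comp hv
  refine (WithLp.measurable_toLp 2 _).comp (measurable_pi_lambda _ fun i => ?_)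
  simp only [Matrix.mulVec, dotProduct]
  exact Finset.measurable_fun_sum _ fun j _ => (hM i j).mul ((measurable_pi_apply j).comp hv')

theorem measurable_gram (lam : ℝ) (t : ℕ) (i j : Fin d) :
    Measurable fun h : History Z A m t => G.gram lam h i j := by
  simp only [gram, Matrix.add_apply, Matrix.sum_apply]
  refine measurable_const.add (Finset.measurable_fun_sum _ fun s _ => ?_)
  have hs : ∀ i j, Measurable fun h : History Z A m t => G.obs (h s).1 (h s).2.1 i j := by
    intro i j
    have h1 : Measurable fun h : History Z A m t => ((h s).1, (h s).2.1) := by fun_prop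
    exact (G.measurable_obs i j).comp h1
  exact measurable_mul (M := fun h : History Z A m t => (G.obs (h s).1 (h s).2.1).transpose)
    (fun i j => hs j i) hs i j

theorem measurable_thetaHat (lam : ℝ) (t : ℕ) :
    Measurable fun h : History Z A m t => G.thetaHat lam h := by
  refine measurable_app (measurable_inv (G.measurable_gram lam t)) ?_
  refine Finset.measurable_fun_sum _ fun s _ => ?_
  refine measurable_app (fun i j => ?_) (by fun_prop)
  have h1 : Measurable fun h : History Z A m t => ((h s).1, (h s).2.1) := by fun_prop
  exact (G.measurable_obs j i).comp h1

theorem measurable_radius (lam B rho : ℝ) (t : ℕ) :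
    Measurable fun h : History Z A m t => G.radius h lam B rho := by
  have := measurable_det (G.measurable_gram lam t)
  unfold radius
  fun_prop

theorem measurable_beta (lam B rho : ℝ) (t : ℕ) :
    Measurable fun h : History Z A m t => G.beta lam B rho h :=
  (G.measurable_radius lam B rho t).pow_const 2

theorem measurableSet_mem_confSet (θ : Vec d) (lam B rho : ℝ) (t : ℕ) :
    MeasurableSet {h : History Z A m t | θ ∈ G.confSet lam B rho h} := by
  have h1 : Measurable fun h : History Z A m t => θ - G.thetaHat lam h :=
    measurable_const.sub (G.measurable_thetaHat lam t)
  exact measurableSet_le (h1.inner (measurable_app (G.measurable_gram lam t) h1))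
    (G.measurable_beta lam B rho t)

theorem measurable_infoGain (lam : ℝ) (t : ℕ) :
    Measurable fun p : (History Z A m t × Z) × A => G.infoGain lam p.1.1 p.2 p.1.2 := by
  have h1 : ∀ i j, Measurable fun p : (History Z A m t × Z) × A => G.obs p.1.2 p.2 i j := by
    intro i j
    have : Measurable fun p : (History Z A m t × Z) × A => (p.1.2, p.2) := by fun_prop
    exact (G.measurable_obs i j).comp this
  have h2 : ∀ i j, Measurable fun p : (History Z A m t × Z) × A => (G.gram lam p.1.1)⁻¹ i j :=
    fun i j => (measurable_inv (G.measurable_gram lam t) i j).comp (by fun_prop)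
  unfold infoGain
  refine (Real.measurable_log.comp (measurable_det fun i j => ?_)).const_mul _
  simp only [Matrix.add_apply]
  exact measurable_const.add (measurable_mul (measurable_mul h1 h2)
    (N := fun p : (History Z A m t × Z) × A => (G.obs p.1.2 p.2).transpose)
    (fun i j => h1 j i) i j)

theorem measurableSet_mem_avail : MeasurableSet {p : Z × A | p.2 ∈ G.avail p.1} := by
  let := TopologicalSpace.metrizableSpaceMetric A
  have := measurableSet_exists_mem_le (X := Z × A) (S := fun p => G.avail p.1)
    (f := fun p b => dist b p.2) (fun p => G.avail_closed p.1)
    (fun F hF => measurable_fst (G.avail_measurable F hF)) (fun p => by fun_prop)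
    (fun b => by fun_prop) 0
  convert this using 1
  ext p
  constructor
  · exact fun hp => ⟨p.2, hp, by simp⟩
  · rintro ⟨b, hb, h0⟩
    have : b = p.2 := dist_le_zero.1 h0
    rw [Set.mem_ofPred_eq, ← this]
    exact hb

end Measurability

/-! ### Gaps -/

section Gap

variable (G : ContextualGame Z A d m) (θ : Vec d)

theorem inner_feat_sub_le (hfeat : ∀ x, ∀ b ∈ G.avail x, ∀ c ∈ G.avail x,
    ‖G.feat x b - G.feat x c‖ ≤ 1) {z : Z} {a b : A} (ha : a ∈ G.avail z) (hb : b ∈ G.avail z) :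
    inner ℝ (G.feat z b - G.feat z a) θ ≤ ‖θ‖ :=
  (real_inner_le_norm _ _).trans
    (mul_le_of_le_one_left (norm_nonneg _) (hfeat z b hb a ha))

variable {θ}

theorem maxGap_bddAbove (hfeat : ∀ x, ∀ b ∈ G.avail x, ∀ c ∈ G.avail x,
    ‖G.feat x b - G.feat x c‖ ≤ 1) :
    BddAbove {r | ∃ z, ∃ a ∈ G.avail z, ∃ b ∈ G.avail z,
      r = inner ℝ (G.feat z a - G.feat z b) θ} := by
  refine ⟨‖θ‖, ?_⟩
  rintro r ⟨z, a, ha, b, hb, rfl⟩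
  exact G.inner_feat_sub_le θ hfeat hb ha

theorem le_maxGap (hfeat : ∀ x, ∀ b ∈ G.avail x, ∀ c ∈ G.avail x,
    ‖G.feat x b - G.feat x c‖ ≤ 1) {z : Z} {a b : A} (ha : a ∈ G.avail z) (hb : b ∈ G.avail z) :
    inner ℝ (G.feat z b - G.feat z a) θ ≤ G.maxGap θ :=
  le_csSup (G.maxGap_bddAbove hfeat) ⟨z, b, hb, a, ha, rfl⟩

theorem maxGap_le (hfeat : ∀ x, ∀ b ∈ G.avail x, ∀ c ∈ G.avail x,
    ‖G.feat x b - G.feat x c‖ ≤ 1) : G.maxGap θ ≤ ‖θ‖ := by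
  refine Real.sSup_le ?_ (norm_nonneg _)
  rintro r ⟨z, a, ha, b, hb, rfl⟩
  exact G.inner_feat_sub_le θ hfeat hb ha

theorem maxGap_nonneg [Nonempty Z] (hfeat : ∀ x, ∀ b ∈ G.avail x, ∀ c ∈ G.avail x,
    ‖G.feat x b - G.feat x c‖ ≤ 1) : 0 ≤ G.maxGap θ := by
  obtain ⟨z⟩ := ‹Nonempty Z›
  obtain ⟨a, ha⟩ := G.avail_nonempty z
  simpa using G.le_maxGap (θ := θ) hfeat ha ha

theorem gap_bddAbove (hfeat : ∀ x, ∀ b ∈ G.avail x, ∀ c ∈ G.avail x,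
    ‖G.feat x b - G.feat x c‖ ≤ 1) {z : Z} {a : A} (ha : a ∈ G.avail z) :
    BddAbove {r | ∃ b ∈ G.avail z, r = inner ℝ (G.feat z b - G.feat z a) θ} := by
  refine ⟨‖θ‖, ?_⟩
  rintro r ⟨b, hb, rfl⟩
  exact G.inner_feat_sub_le θ hfeat ha hb

theorem gap_nonneg (hfeat : ∀ x, ∀ b ∈ G.avail x, ∀ c ∈ G.avail x,
    ‖G.feat x b - G.feat x c‖ ≤ 1) {z : Z} {a : A} (ha : a ∈ G.avail z) : 0 ≤ G.gap θ a z :=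
  le_csSup (G.gap_bddAbove hfeat ha) ⟨a, ha, by simp⟩

theorem gap_le_maxGap (hfeat : ∀ x, ∀ b ∈ G.avail x, ∀ c ∈ G.avail x,
    ‖G.feat x b - G.feat x c‖ ≤ 1) {z : Z} {a : A} (ha : a ∈ G.avail z) :
    G.gap θ a z ≤ G.maxGap θ := by
  refine csSup_le ⟨_, a, ha, rfl⟩ ?_
  rintro r ⟨b, hb, rfl⟩
  exact G.le_maxGap hfeat ha hb

theorem measurable_gap [CompactSpace A] [TopologicalSpace.MetrizableSpace A]
    [MeasurableSpace A] [BorelSpace A] : Measurable fun p : Z × A => G.gap θ p.2 p.1 := by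
  obtain ⟨μ, hμ, hle, hex⟩ := exists_measurable_min (X := Z × A) (S := fun p => G.avail p.1)
    (f := fun p b => -inner ℝ (G.feat p.1 b - G.feat p.1 p.2) θ) (fun p => G.avail_closed p.1)
    (fun p => G.avail_nonempty p.1)
    (fun F hF => measurable_fst (G.avail_measurable F hF))
    (fun p => by have := G.feat_continuous p.1; fun_prop)
    (fun b => by
      have h1 : Measurable fun p : Z × A => G.feat p.1 b :=
        (G.feat_measurable b).comp measurable_fst
      exact ((h1.sub G.measurable_feat).inner measurable_const).neg)
  -- By compactness the supremum is attained, so the gap is minus a measurable minimum.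
  have : (fun p : Z × A => G.gap θ p.2 p.1) = fun p => -μ p := by
    funext p
    obtain ⟨b, hb, he⟩ := hex p
    refine IsGreatest.csSup_eq ⟨⟨b, hb, by rw [← he, neg_neg]⟩, ?_⟩
    rintro r ⟨c, hc, rfl⟩
    have := hle p c hc
    linarith
  rw [this]
  exact hμ.neg

end Gap

end ContextualGame

/-! ### Exponential moments of conditionally sub-Gaussian noise -/

section SubGaussian

variable {Ω : Type*} {m₁ m₀ : MeasurableSpace Ω} {m : ℕ} {P : Measure Ω} [IsProbabilityMeasure P]
  {ε : Ω → Vec m} {rho : ℝ}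

theorem setLIntegral_exp_inner_le (hm : m₁ ≤ m₀) {u : Vec m}
    (hint : Integrable (fun o => Real.exp (inner ℝ u (ε o))) P)
    (hsub : P[fun o => Real.exp (inner ℝ u (ε o)) | m₁]
      ≤ᵐ[P] fun _ => Real.exp (‖u‖ ^ 2 * rho ^ 2 / 2)) {s : Set Ω} (hs : MeasurableSet[m₁] s) :
    ∫⁻ o in s, ENNReal.ofReal (Real.exp (inner ℝ u (ε o))) ∂P ≤
      ENNReal.ofReal (Real.exp (‖u‖ ^ 2 * rho ^ 2 / 2)) * P s := by
  rw [← ofReal_integral_eq_lintegral_ofReal hint.integrableOn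
    (Filter.Eventually.of_forall fun o => (Real.exp_pos _).le), ← setIntegral_condExp hm hint hs]
  have h1 : ∫ o in s, (P[fun o => Real.exp (inner ℝ u (ε o)) | m₁]) o ∂P ≤
      ∫ o in s, Real.exp (‖u‖ ^ 2 * rho ^ 2 / 2) ∂P :=
    setIntegral_mono_ae integrable_condExp.integrableOn (integrable_const _).integrableOn hsub
  rw [setIntegral_const, smul_eq_mul, mul_comm] at h1
  refine (ENNReal.ofReal_le_ofReal h1).trans ?_
  rw [ENNReal.ofReal_mul (Real.exp_pos _).le, Measure.real, ENNReal.ofReal_toReal (by finiteness)]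

/-- The conditional bound says that P reweighted by the exponential factor is dominated by P on
`m₁`. It remains to integrate the `m₁`-measurable D against both measures. -/
theorem lintegral_mul_exp_inner_const_le (hm : m₁ ≤ m₀) (hε : Measurable ε) {u : Vec m}
    (hint : Integrable (fun o => Real.exp (inner ℝ u (ε o))) P)
    (hsub : P[fun o => Real.exp (inner ℝ u (ε o)) | m₁]
      ≤ᵐ[P] fun _ => Real.exp (‖u‖ ^ 2 * rho ^ 2 / 2)) {D : Ω → ℝ≥0∞} (hD : Measurable[m₁] D) :
    ∫⁻ o, D o * ENNReal.ofReal (Real.exp (inner ℝ u (ε o) - ‖u‖ ^ 2 * rho ^ 2 / 2)) ∂P ≤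
      ∫⁻ o, D o ∂P := by
  have hexp : Measurable fun o => ENNReal.ofReal
      (Real.exp (inner ℝ u (ε o) - ‖u‖ ^ 2 * rho ^ 2 / 2)) := by fun_prop
  have hle : (P.withDensity fun o => ENNReal.ofReal
      (Real.exp (inner ℝ u (ε o) - ‖u‖ ^ 2 * rho ^ 2 / 2))).trim hm ≤ P.trim hm := by
    refine Measure.le_iff.2 fun s hs => ?_
    rw [trim_measurableSet_eq hm hs, trim_measurableSet_eq hm hs, withDensity_apply _ (hm s hs)]
    have hsplit : ∀ o, ENNReal.ofReal (Real.exp (inner ℝ u (ε o) - ‖u‖ ^ 2 * rho ^ 2 / 2)) =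
        ENNReal.ofReal (Real.exp (-(‖u‖ ^ 2 * rho ^ 2 / 2))) *
          ENNReal.ofReal (Real.exp (inner ℝ u (ε o))) := fun o => by
      rw [← ENNReal.ofReal_mul (Real.exp_pos _).le, ← Real.exp_add]
      congr 2
      ring
    simp only [hsplit]
    rw [lintegral_const_mul' _ _ ENNReal.ofReal_ne_top]
    refine (mul_le_mul_right (setLIntegral_exp_inner_le hm hint hsub hs) _).trans ?_
    rw [← mul_assoc, ← ENNReal.ofReal_mul (Real.exp_pos _).le, ← Real.exp_add]
    simp
  calc ∫⁻ o, D o * ENNReal.ofReal (Real.exp (inner ℝ u (ε o) - ‖u‖ ^ 2 * rho ^ 2 / 2)) ∂P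
      = ∫⁻ o, D o ∂(P.withDensity fun o => ENNReal.ofReal
          (Real.exp (inner ℝ u (ε o) - ‖u‖ ^ 2 * rho ^ 2 / 2))) := by
        rw [lintegral_withDensity_eq_lintegral_mul _ hexp (hD.mono hm le_rfl)]
        simp [mul_comm]
    _ = ∫⁻ o, D o ∂(P.withDensity fun o => ENNReal.ofReal
          (Real.exp (inner ℝ u (ε o) - ‖u‖ ^ 2 * rho ^ 2 / 2))).trim hm :=
        (lintegral_trim hm hD).symm
    _ ≤ ∫⁻ o, D o ∂P.trim hm := lintegral_mono' hle le_rfl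
    _ = ∫⁻ o, D o ∂P := lintegral_trim hm hD

/-- The sub-Gaussian bound in a direction that depends on the past. -/
theorem lintegral_mul_exp_inner_le (hm : m₁ ≤ m₀) (hε : Measurable ε)
    (hint : ∀ u, Integrable (fun o => Real.exp (inner ℝ u (ε o))) P)
    (hsub : ∀ u, P[fun o => Real.exp (inner ℝ u (ε o)) | m₁]
      ≤ᵐ[P] fun _ => Real.exp (‖u‖ ^ 2 * rho ^ 2 / 2)) {D : Ω → ℝ≥0∞} (hD : Measurable[m₁] D)
    {U : Ω → Vec m} (hU : Measurable[m₁] U) :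
    ∫⁻ o, D o * ENNReal.ofReal (Real.exp (inner ℝ (U o) (ε o) - ‖U o‖ ^ 2 * rho ^ 2 / 2)) ∂P ≤
      ∫⁻ o, D o ∂P := by
  have hD₀ : Measurable D := hD.mono hm le_rfl
  have hU₀ : Measurable U := hU.mono hm le_rfl
  let F : Vec m → Ω → ℝ≥0∞ := fun u o =>
    ENNReal.ofReal (Real.exp (inner ℝ u (ε o) - ‖u‖ ^ 2 * rho ^ 2 / 2))
  have hF : ∀ V : Ω → Vec m, Measurable V → Measurable fun o => F (V o) o := fun V hV => by
    simp only [F]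
    fun_prop
  let φ : ℕ → SimpleFunc (Vec m) (Vec m) := (stronglyMeasurable_id (α := Vec m)).approx
  have hφ : ∀ u, Filter.Tendsto (fun k => φ k u) Filter.atTop (nhds u) :=
    (stronglyMeasurable_id (α := Vec m)).tendsto_approx
  -- A simple approximation of U takes finitely many values; cutting D along its fibres, which lie
  -- in `m₁`, reduces to constant directions. Fatou's lemma then passes to U.
  have hsimple : ∀ k, ∫⁻ o, D o * F (φ k (U o)) o ∂P ≤ ∫⁻ o, D o ∂P := by
    intro k
    let E : Vec m → Ω → ℝ≥0∞ := fun u => (U ⁻¹' (φ k ⁻¹' {u})).indicator D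
    have hEm : ∀ u, Measurable[m₁] (E u) := fun u =>
      hD.indicator (hU ((φ k).measurableSet_fiber u))
    have hEsum : ∀ (H : Vec m → ℝ≥0∞) (o : Ω),
        ∑ u ∈ (φ k).range, E u o * H u = D o * H (φ k (U o)) := by
      intro H o
      rw [Finset.sum_eq_single (φ k (U o))]
      · simp [E]
      · intro u _ hu
        have : o ∉ U ⁻¹' (φ k ⁻¹' {u}) := fun ho => hu ho.symm
        simp [E, Set.indicator_of_notMem this]
      · exact fun hn => absurd ((φ k).mem_range_self _) hn
    calc ∫⁻ o, D o * F (φ k (U o)) o ∂P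
        = ∫⁻ o, ∑ u ∈ (φ k).range, E u o * F u o ∂P :=
          lintegral_congr fun o => (hEsum (fun u => F u o) o).symm
      _ = ∑ u ∈ (φ k).range, ∫⁻ o, E u o * F u o ∂P :=
          lintegral_finsetSum _ fun u _ =>
            ((hEm u).mono hm le_rfl).mul (hF (fun _ => u) measurable_const)
      _ ≤ ∑ u ∈ (φ k).range, ∫⁻ o, E u o ∂P :=
          Finset.sum_le_sum fun u _ =>
            lintegral_mul_exp_inner_const_le hm hε (hint u) (hsub u) (hEm u)
      _ = ∫⁻ o, ∑ u ∈ (φ k).range, E u o ∂P :=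
          (lintegral_finsetSum _ fun u _ => (hEm u).mono hm le_rfl).symm
      _ = ∫⁻ o, D o ∂P := lintegral_congr fun o => by simpa using hEsum (fun _ => 1) o
  have hlim : ∀ o, Filter.liminf (fun k => D o * F (φ k (U o)) o) Filter.atTop =
      D o * F (U o) o := by
    intro o
    refine Filter.Tendsto.liminf_eq (ENNReal.Tendsto.const_mul ?_ (Or.inl ?_))
    · have hc : Continuous fun u => F u o := by
        simp only [F]
        exact ENNReal.continuous_ofReal.comp (by fun_prop)
      exact (hc.tendsto _).comp (hφ (U o))
    · simp [F, Real.exp_pos]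
  calc ∫⁻ o, D o * F (U o) o ∂P
      = ∫⁻ o, Filter.liminf (fun k => D o * F (φ k (U o)) o) Filter.atTop ∂P :=
        lintegral_congr fun o => (hlim o).symm
    _ ≤ Filter.liminf (fun k => ∫⁻ o, D o * F (φ k (U o)) o ∂P) Filter.atTop :=
        lintegral_liminf_le fun k => hD₀.mul (hF _ ((φ k).measurable.comp hU₀))
    _ ≤ ∫⁻ o, D o ∂P := by
        refine (Filter.liminf_le_liminf (Filter.Eventually.of_forall hsimple)).trans ?_
        simp

end SubGaussian

/-! ### A Gaussian integral -/

section Gaussian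

variable {d : ℕ}

/-- The unnormalised Gaussian integral. -/
def gaussConst (d : ℕ) : ℝ≥0∞ := ∫⁻ u : Vec d, ENNReal.ofReal (Real.exp (-(1 / 2) * ‖u‖ ^ 2))

theorem gaussConst_eq (d : ℕ) :
    gaussConst d = ENNReal.ofReal (∫ u : Vec d, Real.exp (-(1 / 2) * ‖u‖ ^ 2)) ∧
      0 < ∫ u : Vec d, Real.exp (-(1 / 2) * ‖u‖ ^ 2) := by
  have h0 : 0 < ∫ u : Vec d, Real.exp (-(1 / 2) * ‖u‖ ^ 2) := by
    rw [GaussianFourier.integral_rexp_neg_mul_sq_norm (by norm_num)]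
    positivity
  refine ⟨(ofReal_integral_eq_lintegral_ofReal ?_
    (Filter.Eventually.of_forall fun o => (Real.exp_pos _).le)).symm, h0⟩
  -- A non-integrable function would have Bochner integral 0, so the positive value proves
  -- integrability.
  by_contra hni
  rw [integral_undef hni] at h0
  exact h0.false

theorem gaussConst_ne_zero (d : ℕ) : gaussConst d ≠ 0 := by
  obtain ⟨h1, h2⟩ := gaussConst_eq d
  rw [h1]
  exact (ENNReal.ofReal_pos.2 h2).ne'

theorem gaussConst_ne_top (d : ℕ) : gaussConst d ≠ ∞ := by
  rw [(gaussConst_eq d).1]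
  exact ENNReal.ofReal_ne_top

theorem det_appL (R : Matrix (Fin d) (Fin d) ℝ) :
    LinearMap.det ((appL R : Vec d →L[ℝ] Vec d) : Vec d →ₗ[ℝ] Vec d) = R.det := by
  have : ((appL R : Vec d →L[ℝ] Vec d) : Vec d →ₗ[ℝ] Vec d) =
      Matrix.toLin (EuclideanSpace.basisFun (Fin d) ℝ).toBasis
        (EuclideanSpace.basisFun (Fin d) ℝ).toBasis R := by
    rw [← Matrix.toEuclideanLin_eq_toLin_orthonormal]
    rfl
  rw [this, LinearMap.det_toLin]

/-- Completing the square leaves -½‖Ru - R⁻ᵀs‖². The substitution by R contributes |det R|⁻¹ =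
exp(-½ log det V). -/
theorem lintegral_exp_quadratic {V R : Matrix (Fin d) (Fin d) ℝ} (hVR : V = R.transpose * R)
    (hR : IsUnit R.det) (s : Vec d) :
    ∫⁻ u : Vec d, ENNReal.ofReal (Real.exp (inner ℝ u s - 1 / 2 * inner ℝ u (app V u))) =
      ENNReal.ofReal (Real.exp (1 / 2 * inner ℝ s (app V⁻¹ s) - 1 / 2 * Real.log V.det)) *
        gaussConst d := by
  let f : Vec d → ℝ≥0∞ := fun w => ENNReal.ofReal (Real.exp (-(1 / 2) * ‖w‖ ^ 2))
  have hf : Measurable f := by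
    simp only [f]
    fun_prop
  set T := app R⁻¹.transpose s
  have hdet : V.det = R.det ^ 2 := by
    rw [hVR, Matrix.det_mul, Matrix.det_transpose, sq]
  have hexp : ∀ u, ENNReal.ofReal (Real.exp (inner ℝ u s - 1 / 2 * inner ℝ u (app V u))) =
      ENNReal.ofReal (Real.exp (1 / 2 * inner ℝ s (app V⁻¹ s))) * f (appL R u - T) := by
    intro u
    simp only [f]
    rw [← ENNReal.ofReal_mul (Real.exp_pos _).le, ← Real.exp_add, appL_apply, norm_sub_sq_real,
      norm_app_factor_sq hVR, norm_app_factor_inv_sq hVR, real_inner_comm T,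
      ← inner_eq_inner_factor hR, real_inner_comm u s]
    congr 2
    ring
  have hdetL : LinearMap.det ((appL R : Vec d →L[ℝ] Vec d) : Vec d →ₗ[ℝ] Vec d) ≠ 0 := by
    rw [det_appL]
    exact hR.ne_zero
  have hmap := Measure.map_linearMap_addHaar_eq_smul_addHaar (μ := (volume : Measure (Vec d))) hdetL
  simp only [hexp]
  rw [lintegral_const_mul' _ _ ENNReal.ofReal_ne_top]
  have h1 : ∫⁻ u : Vec d, f (appL R u - T) =
      ENNReal.ofReal |(R.det)⁻¹| * gaussConst d := by
    have h2 : ∫⁻ w, f (w - T) ∂(volume.map (appL R)) = ∫⁻ u : Vec d, f (appL R u - T) :=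
      lintegral_map (hf.comp (measurable_id.sub_const T)) (appL R).continuous.measurable
    rw [← h2]
    have h3 : (volume : Measure (Vec d)).map (appL R) = ENNReal.ofReal |(R.det)⁻¹| • volume := by
      rw [← det_appL]
      exact hmap
    rw [h3, lintegral_smul_measure, lintegral_sub_right_eq_self f T]
    rfl
  rw [h1, ← mul_assoc, ← ENNReal.ofReal_mul (Real.exp_pos _).le, Real.exp_sub]
  congr 3
  rw [div_eq_mul_inv, hdet, abs_inv]
  congr 2
  rw [Real.log_pow, Nat.cast_ofNat, one_mul, inv_mul_cancel_left₀ two_ne_zero,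
    Real.exp_log_eq_abs hR.ne_zero]

end Gaussian

namespace ContextualGame

theorem measurable_hist {Z A Ω : Type*} [MeasurableSpace Z] [MeasurableSpace A]
    [MeasurableSpace Ω] {m : ℕ} {z : ℕ → Ω → Z} {a : ℕ → Ω → A} {y : ℕ → Ω → Vec m}
    (hz : ∀ t, Measurable (z t)) (ha : ∀ t, Measurable (a t)) (hy : ∀ t, Measurable (y t))
    (t : ℕ) : Measurable (hist z a y t) :=
  measurable_pi_lambda _ fun s => (hz s).prodMk ((ha s).prodMk (hy s))

variable {Z A : Type*} [MeasurableSpace Z] [TopologicalSpace A] {d m : ℕ}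

/-! ### The confidence sets -/

section Confidence

variable (G : ContextualGame Z A d m) (θ : Vec d) {Ω : Type*} (z : ℕ → Ω → Z) (a : ℕ → Ω → A)
  (y : ℕ → Ω → Vec m)

/-- The noise of a round. -/
def noise (s : ℕ) (o : Ω) : Vec m := y s o - app (G.obs (z s o) (a s o)) θ

/-- The accumulated noise `∑ₛ Mₛᵀ εₛ`. -/
def noiseSum (t : ℕ) (o : Ω) : Vec d :=
  ∑ s ∈ Finset.range t, app (G.obs (z s o) (a s o)).transpose (G.noise θ z a y s o)

variable {lam : ℝ}

/-- The normal equations split the estimation error into a regularisation bias and the accumulated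
noise. -/
theorem app_gram_thetaHat_sub (hlam : 0 < lam) (t : ℕ) (o : Ω) :
    app (G.gram lam (hist z a y t o)) (θ - G.thetaHat lam (hist z a y t o)) =
      lam • θ - G.noiseSum θ z a y t o := by
  have hV := G.gram_posDef (hist z a y t o) hlam
  rw [thetaHat, app_sub, ← app_mul, Matrix.mul_nonsing_inv _ hV.det_pos.ne'.isUnit, app_one]
  rw [gram, app_matrix_add, app_matrix_smul, app_one, app_matrix_sum, add_sub_assoc,
    ← Finset.sum_sub_distrib, noiseSum, Finset.sum_range, sub_eq_add_neg,
    ← Finset.sum_neg_distrib]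
  congr 1
  refine Finset.sum_congr rfl fun s _ => ?_
  simp only [noise, app_sub, app_mul, hist]
  abel

/-- Triangle inequality in the V⁻¹-norm: the noise gives the first term of √β, and the bias λθ has
norm at most √λ B because V ≥ λ. -/
theorem mem_confSet_of_le (hlam : 0 < lam) {B rho : ℝ} (hB : ‖θ‖ ≤ B) (hrho : 0 ≤ rho)
    (t : ℕ) (o : Ω)
    (hQ : inner ℝ (G.noiseSum θ z a y t o)
        (app (G.gram lam (hist z a y t o))⁻¹ (G.noiseSum θ z a y t o)) ≤
      rho ^ 2 * (2 * Real.log (1 / (1 / ((t : ℝ) + 1) ^ 2)) +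
        Real.log (G.gram lam (hist z a y t o)).det
          - Real.log (lam • (1 : Matrix (Fin d) (Fin d) ℝ)).det)) :
    θ ∈ G.confSet lam B rho (hist z a y t o) := by
  obtain ⟨R, hVR, hR⟩ := exists_transpose_mul_self (G.gram_posDef (hist z a y t o) hlam)
  set S := G.noiseSum θ z a y t o
  set h := hist z a y t o
  rw [confSet, Set.mem_ofPred_eq, ← norm_app_factor_sq hVR, beta_eq]
  refine pow_le_pow_left₀ (norm_nonneg _) ?_ 2
  have h1 : app R (θ - G.thetaHat lam h) = app R⁻¹.transpose (lam • θ - S) := by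
    rw [← G.app_gram_thetaHat_sub θ z a y hlam t o, hVR, app_mul, ← app_mul, ← Matrix.transpose_mul,
      Matrix.mul_nonsing_inv _ hR, Matrix.transpose_one, app_one]
  rw [← norm_app_factor_inv_sq hVR] at hQ
  have h2 : ‖app R⁻¹.transpose S‖ ≤ rho * √(2 * Real.log (1 / (1 / ((t : ℝ) + 1) ^ 2)) +
        Real.log (G.gram lam h).det - Real.log (lam • (1 : Matrix (Fin d) (Fin d) ℝ)).det) := by
    have := Real.sqrt_le_sqrt hQ
    rwa [Real.sqrt_sq (norm_nonneg _), Real.sqrt_mul (sq_nonneg _), Real.sqrt_sq hrho] at this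
  have h3 : ‖app R⁻¹.transpose (lam • θ)‖ ≤ √lam * B := by
    have h4 := sqrt_mul_norm_factor_inv_le hR (G.mul_norm_sq_le_factor h hVR) θ
    rw [app_smul, norm_smul, Real.norm_of_nonneg hlam.le]
    calc lam * ‖app R⁻¹.transpose θ‖ = √lam * (√lam * ‖app R⁻¹.transpose θ‖) := by
          rw [← mul_assoc, Real.mul_self_sqrt hlam.le]
      _ ≤ √lam * B := by gcongr; exact h4.trans hB
  rw [h1, app_sub, radius]
  refine (norm_sub_le _ _).trans ?_
  linarith

variable [CompactSpace A] [TopologicalSpace.MetrizableSpace A] [MeasurableSpace A] [BorelSpace A]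

theorem measurable_noiseSum [MeasurableSpace Ω] {t : ℕ} (hz : ∀ s < t, Measurable (z s))
    (ha : ∀ s < t, Measurable (a s)) (hy : ∀ s < t, Measurable (y s)) :
    Measurable (G.noiseSum θ z a y t) := by
  refine Finset.measurable_fun_sum _ fun s hs => ?_
  have hs := Finset.mem_range.1 hs
  have hobs : ∀ i j, Measurable fun o => G.obs (z s o) (a s o) i j := fun i j =>
    (G.measurable_obs i j).comp ((hz s hs).prodMk (ha s hs))
  exact measurable_app (fun i j => hobs j i) ((hy s hs).sub (measurable_app hobs measurable_const))

variable [MeasurableSpace Ω] {χ : Measure Z} {rho : ℝ}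
  {ξ : ∀ t : ℕ, Kernel (History Z A m t × Z) A} {n : ℕ} {P : Measure Ω} [IsProbabilityMeasure P]
  {G θ z a y}

/-- The exponential is a supermartingale in each fixed direction u. The noise is normalised by a
positive r ≥ `rho` because `rho` may be 0. -/
theorem IsInteraction.lintegral_exp_noiseSum_le (hI : G.IsInteraction χ θ rho ξ n P z a y)
    (hrho : 0 ≤ rho) {r : ℝ} (hr : 0 < r) (hrr : rho ≤ r) (u : Vec d) (t : ℕ) (ht : t ≤ n) :
    ∫⁻ o, ENNReal.ofReal (Real.exp (inner ℝ u (r⁻¹ • G.noiseSum θ z a y t o) -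
      1 / 2 * ∑ s ∈ Finset.range t, ‖app (G.obs (z s o) (a s o)) u‖ ^ 2)) ∂P ≤ 1 := by
  induction t with
  | zero => simp [noiseSum]
  | succ t ih =>
    refine le_trans ?_ (ih (by omega))
    have htn : t < n := ht
    let X : Ω → (History Z A m t × Z) × A := fun o => ((hist z a y t o, z t o), a t o)
    have hX : Measurable X :=
      ((measurable_hist hI.measurable_context hI.measurable_action
        hI.measurable_observation t).prodMk (hI.measurable_context t)).prodMk
        (hI.measurable_action t)
    have hε : Measurable (G.noise θ z a y t) := by
      have hobs₀ : ∀ i j, Measurable fun o => G.obs (z t o) (a t o) i j := fun i j =>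
        (G.measurable_obs i j).comp ((hI.measurable_context t).prodMk (hI.measurable_action t))
      exact (hI.measurable_observation t).sub (measurable_app hobs₀ measurable_const)
    have hint := hI.noise_integrable t htn
    have hsub := hI.noise_subGaussian t htn
    -- For the σ-algebra of past, context and action, the factor from earlier rounds and the
    -- direction Mu/r of the new noise are both measurable.
    let m₁ : MeasurableSpace Ω := MeasurableSpace.comap X inferInstance
    have hX₁ : Measurable[m₁] X := comap_measurable X
    have hz₁ : ∀ s < t, Measurable[m₁] (z s) := fun s hs =>
      (show Measurable fun p : (History Z A m t × Z) × A => (p.1.1 ⟨s, hs⟩).1 by fun_prop).comp hX₁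
    have ha₁ : ∀ s < t, Measurable[m₁] (a s) := fun s hs =>
      (show Measurable fun p : (History Z A m t × Z) × A => (p.1.1 ⟨s, hs⟩).2.1 by
        fun_prop).comp hX₁
    have hy₁ : ∀ s < t, Measurable[m₁] (y s) := fun s hs =>
      (show Measurable fun p : (History Z A m t × Z) × A => (p.1.1 ⟨s, hs⟩).2.2 by
        fun_prop).comp hX₁
    have hobs₁ : ∀ s < t, ∀ i j, Measurable[m₁] fun o => G.obs (z s o) (a s o) i j :=
      fun s hs i j => (G.measurable_obs i j).comp ((hz₁ s hs).prodMk (ha₁ s hs))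
    have hobs : ∀ i j, Measurable[m₁] fun o => G.obs (z t o) (a t o) i j := fun i j =>
      (G.measurable_obs i j).comp
        ((show Measurable fun p : (History Z A m t × Z) × A => (p.1.2, p.2) by
          fun_prop).comp hX₁)
    have hD : Measurable[m₁] fun o => ENNReal.ofReal (Real.exp
        (inner ℝ u (r⁻¹ • G.noiseSum θ z a y t o) -
          1 / 2 * ∑ s ∈ Finset.range t, ‖app (G.obs (z s o) (a s o)) u‖ ^ 2)) := by
      refine ENNReal.measurable_ofReal.comp (Real.measurable_exp.comp (Measurable.sub ?_ ?_))
      · exact (measurable_const.inner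
          ((@measurable_noiseSum _ _ _ _ _ _ G θ _ z a y _ _ _ _ m₁ t hz₁ ha₁ hy₁).const_smul r⁻¹))
      · refine Measurable.const_mul (Finset.measurable_fun_sum _ fun s hs => ?_) _
        exact ((measurable_app (hobs₁ s (Finset.mem_range.1 hs)) measurable_const).norm).pow_const 2
    have hU : Measurable[m₁] fun o => r⁻¹ • app (G.obs (z t o) (a t o)) u :=
      (measurable_app hobs measurable_const).const_smul r⁻¹
    refine le_trans (lintegral_mono fun o => ?_)
      (lintegral_mul_exp_inner_le (m₁ := m₁) hX.comap_le hε hint hsub hD hU)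
    rw [← ENNReal.ofReal_mul (Real.exp_pos _).le, ← Real.exp_add]
    refine ENNReal.ofReal_le_ofReal (Real.exp_le_exp.2 ?_)
    rw [noiseSum, Finset.sum_range_succ, Finset.sum_range_succ, ← noiseSum, smul_add,
      inner_add_right, inner_smul_right u (app _ _), inner_app_right, Matrix.transpose_transpose,
      inner_smul_left, norm_smul, Real.norm_of_nonneg (inv_nonneg.2 hr.le)]
    have h1 : (r⁻¹ * ‖app (G.obs (z t o) (a t o)) u‖) ^ 2 * rho ^ 2 ≤
        ‖app (G.obs (z t o) (a t o)) u‖ ^ 2 := by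
      have : (r⁻¹ * rho) ^ 2 ≤ 1 := by
        refine pow_le_one₀ (by positivity) ?_
        rw [inv_mul_le_iff₀ hr, mul_one]
        exact hrr
      calc _ = (r⁻¹ * rho) ^ 2 * ‖app (G.obs (z t o) (a t o)) u‖ ^ 2 := by ring
        _ ≤ 1 * ‖app (G.obs (z t o) (a t o)) u‖ ^ 2 := by gcongr
        _ = _ := one_mul _
    simp only [conj_trivial]
    linarith

/-- Method of mixtures: average the supermartingale bound over u with weight exp(-½λ‖u‖²) and
exchange the integrals. The weight completes ∑MᵀM to V, and its normalisation produces the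
log-determinant difference. -/
theorem IsInteraction.lintegral_exp_selfNormalized_le
    (hI : G.IsInteraction χ θ rho ξ n P z a y) (hlam : 0 < lam)
    (hrho : 0 ≤ rho) {r : ℝ} (hr : 0 < r) (hrr : rho ≤ r) (t : ℕ) (ht : t ≤ n) :
    ∫⁻ o, ENNReal.ofReal (Real.exp (1 / 2 * inner ℝ (r⁻¹ • G.noiseSum θ z a y t o)
        (app (G.gram lam (hist z a y t o))⁻¹ (r⁻¹ • G.noiseSum θ z a y t o)) -
      1 / 2 * (Real.log (G.gram lam (hist z a y t o)).det -
        Real.log (lam • (1 : Matrix (Fin d) (Fin d) ℝ)).det))) ∂P ≤ 1 := by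
  have hS : Measurable (G.noiseSum θ z a y t) := G.measurable_noiseSum θ z a y
    (fun s _ => hI.measurable_context s) (fun s _ => hI.measurable_action s)
    (fun s _ => hI.measurable_observation s)
  have hobs : ∀ s i j, Measurable fun o => G.obs (z s o) (a s o) i j := fun s i j =>
    (G.measurable_obs i j).comp ((hI.measurable_context s).prodMk (hI.measurable_action s))
  let W : Ω → Vec d → ℝ := fun o u => inner ℝ u (r⁻¹ • G.noiseSum θ z a y t o) -
      1 / 2 * ∑ s ∈ Finset.range t, ‖app (G.obs (z s o) (a s o)) u‖ ^ 2
  have hW : Measurable (Function.uncurry W) := by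
    refine Measurable.sub ?_ ?_
    · exact measurable_snd.inner ((hS.comp measurable_fst).const_smul r⁻¹)
    · refine Measurable.const_mul (Finset.measurable_fun_sum _ fun s _ => ?_) _
      exact (measurable_app (fun i j => (hobs s i j).comp measurable_fst)
        measurable_snd).norm.pow_const 2
  let g : Vec d → ℝ≥0∞ := fun u => ENNReal.ofReal (Real.exp (-(1 / 2 * (lam * ‖u‖ ^ 2))))
  have hg : Measurable g := by
    simp only [g]
    fun_prop
  let c := Real.log (lam • (1 : Matrix (Fin d) (Fin d) ℝ)).det
  -- The Gram matrix of the empty history is λI, so the total weight is an instance of the same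
  -- Gaussian integral, with s = 0.
  let V₀ := G.gram lam (fun s : Fin 0 => s.elim0 : History Z A m 0)
  have hV₀ : V₀ = lam • (1 : Matrix (Fin d) (Fin d) ℝ) := by simp [V₀, gram]
  have hgauss₀ : ∫⁻ u, g u = ENNReal.ofReal (Real.exp (-(1 / 2 * c))) * gaussConst d := by
    obtain ⟨R, hVR, hR⟩ := exists_transpose_mul_self (G.gram_posDef
      (fun s : Fin 0 => s.elim0 : History Z A m 0) hlam)
    have := lintegral_exp_quadratic hVR hR 0
    rw [show G.gram lam (fun s : Fin 0 => s.elim0 : History Z A m 0) = _ from hV₀] at this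
    simpa [g, c, app_matrix_smul, inner_smul_right] using this
  have hgauss : ∀ o, ∫⁻ u, g u * ENNReal.ofReal (Real.exp (W o u)) =
      ENNReal.ofReal (Real.exp (1 / 2 * inner ℝ (r⁻¹ • G.noiseSum θ z a y t o)
        (app (G.gram lam (hist z a y t o))⁻¹ (r⁻¹ • G.noiseSum θ z a y t o)) -
          1 / 2 * Real.log (G.gram lam (hist z a y t o)).det)) * gaussConst d := by
    intro o
    obtain ⟨R, hVR, hR⟩ := exists_transpose_mul_self (G.gram_posDef (hist z a y t o) hlam)
    rw [← lintegral_exp_quadratic hVR hR]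
    refine lintegral_congr fun u => ?_
    simp only [g]
    rw [← ENNReal.ofReal_mul (Real.exp_pos _).le, ← Real.exp_add, inner_app_gram]
    congr 2
    simp only [W, hist, Finset.sum_range]
    ring
  have hmain : ∫⁻ o, (∫⁻ u, g u * ENNReal.ofReal (Real.exp (W o u))) ∂P ≤ ∫⁻ u, g u := by
    rw [lintegral_lintegral_swap]
    · refine lintegral_mono fun u => ?_
      simp only
      rw [lintegral_const_mul' _ _ ENNReal.ofReal_ne_top]
      exact mul_le_of_le_one_right zero_le
        (hI.lintegral_exp_noiseSum_le hrho hr hrr u t ht)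
    · refine Measurable.aemeasurable ?_
      exact (hg.comp measurable_snd).mul
        (ENNReal.measurable_ofReal.comp (Real.measurable_exp.comp hW))
  simp only [hgauss] at hmain
  rw [lintegral_mul_const' _ _ (gaussConst_ne_top d), hgauss₀,
    ENNReal.mul_le_mul_iff_left (gaussConst_ne_zero d) (gaussConst_ne_top d)] at hmain
  calc _ = ∫⁻ o, ENNReal.ofReal (Real.exp (1 / 2 * c)) *
        ENNReal.ofReal (Real.exp (1 / 2 * inner ℝ (r⁻¹ • G.noiseSum θ z a y t o)
        (app (G.gram lam (hist z a y t o))⁻¹ (r⁻¹ • G.noiseSum θ z a y t o)) -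
          1 / 2 * Real.log (G.gram lam (hist z a y t o)).det)) ∂P := by
        refine lintegral_congr fun o => ?_
        rw [← ENNReal.ofReal_mul (Real.exp_pos _).le, ← Real.exp_add]
        congr 2
        simp only [c]
        ring
    _ ≤ ENNReal.ofReal (Real.exp (1 / 2 * c)) * ENNReal.ofReal (Real.exp (-(1 / 2 * c))) := by
        rw [lintegral_const_mul' _ _ ENNReal.ofReal_ne_top]
        gcongr
    _ = 1 := by
        rw [← ENNReal.ofReal_mul (Real.exp_pos _).le, ← Real.exp_add]
        simp

/-- Markov's inequality for the self-normalised exponential at level (t + 1)². -/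
theorem IsInteraction.measure_notMem_confSet_le
    (hI : G.IsInteraction χ θ rho ξ n P z a y) (hlam : 0 < lam)
    (hrho : 0 ≤ rho) {B : ℝ} (hB : ‖θ‖ ≤ B) (t : ℕ) (ht : t ≤ n) :
    P {o | θ ∉ G.confSet lam B rho (hist z a y t o)} ≤
      ENNReal.ofReal (1 / ((t : ℝ) + 1) ^ 2) := by
  have hS : Measurable (G.noiseSum θ z a y t) := G.measurable_noiseSum θ z a y
    (fun s _ => hI.measurable_context s) (fun s _ => hI.measurable_action s)
    (fun s _ => hI.measurable_observation s)
  have hh := measurable_hist hI.measurable_context hI.measurable_action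
    hI.measurable_observation t
  have hgram : ∀ i j, Measurable fun o => G.gram lam (hist z a y t o) i j := fun i j =>
    (G.measurable_gram lam t i j).comp hh
  let Q : Ω → ℝ := fun o => inner ℝ (G.noiseSum θ z a y t o)
        (app (G.gram lam (hist z a y t o))⁻¹ (G.noiseSum θ z a y t o))
  let D : Ω → ℝ := fun o => Real.log (G.gram lam (hist z a y t o)).det -
        Real.log (lam • (1 : Matrix (Fin d) (Fin d) ℝ)).det
  have hQ : Measurable Q := hS.inner (measurable_app (measurable_inv hgram) hS)
  have hD : Measurable D := (Real.measurable_log.comp (measurable_det hgram)).sub_const _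
  have hD0 : ∀ o, 0 ≤ D o := fun o => by
    simp only [D]
    rw [G.log_det_gram_hist hlam]
    have : 0 ≤ G.totalInfo lam z a y t o :=
      Finset.sum_nonneg fun s _ => G.infoGain_nonneg _ hlam _ _
    linarith
  set ℓ := Real.log (((t : ℝ) + 1) ^ 2)
  have hpos : (0 : ℝ) < ((t : ℝ) + 1) ^ 2 := by positivity
  have hℓ : 0 ≤ ℓ := Real.log_nonneg (by nlinarith [(Nat.cast_nonneg t : (0 : ℝ) ≤ t)])
  have hbad : ∀ r, 0 < r → rho ≤ r → P {o | r ^ 2 * (2 * ℓ + D o) < Q o} ≤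
      ENNReal.ofReal (1 / ((t : ℝ) + 1) ^ 2) := by
    intro r hr hrr
    have h1 := hI.lintegral_exp_selfNormalized_le hlam hrho hr hrr t ht
    have h2 : ∀ o, inner ℝ (r⁻¹ • G.noiseSum θ z a y t o)
        (app (G.gram lam (hist z a y t o))⁻¹ (r⁻¹ • G.noiseSum θ z a y t o)) =
          (r ^ 2)⁻¹ * Q o := fun o => by
      rw [app_smul, inner_smul_left, inner_smul_right]
      simp only [conj_trivial, Q]
      ring
    simp only [h2] at h1
    have hm : Measurable fun o => ENNReal.ofReal (Real.exp (1 / 2 * ((r ^ 2)⁻¹ * Q o) -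
        1 / 2 * D o)) := by fun_prop
    have h3 := mul_meas_ge_le_lintegral hm (μ := P) (ENNReal.ofReal (((t : ℝ) + 1) ^ 2))
    have h4 := h3.trans h1
    rw [mul_comm, ← ENNReal.le_div_iff_mul_le (Or.inl (ENNReal.ofReal_pos.2 hpos).ne')
      (Or.inl ENNReal.ofReal_ne_top)] at h4
    rw [ENNReal.ofReal_div_of_pos hpos, ENNReal.ofReal_one]
    refine (measure_mono fun o ho => ?_).trans h4
    refine ENNReal.ofReal_le_ofReal ?_
    rw [← Real.log_le_iff_le_exp hpos]
    have h5 : 2 * ℓ + D o < (r ^ 2)⁻¹ * Q o := by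
      rw [lt_inv_mul_iff₀ (by positivity)]
      exact ho
    show ℓ ≤ _
    linarith
  -- Since `rho` may vanish, the strict failure event is exhausted by the increasing events for r =
  -- `rho` + 1/(k + 1), which share one probability bound.
  let E : ℕ → Set Ω := fun k => {o | (rho + 1 / ((k : ℝ) + 1)) ^ 2 * (2 * ℓ + D o) < Q o}
  have hE : Monotone E := by
    intro i j hij o ho
    refine lt_of_le_of_lt ?_
      (show (rho + 1 / ((i : ℝ) + 1)) ^ 2 * (2 * ℓ + D o) < Q o from ho)
    have := hD0 o
    have : (1 : ℝ) / ((j : ℝ) + 1) ≤ 1 / ((i : ℝ) + 1) := by gcongr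
    gcongr
  have hsub : {o | θ ∉ G.confSet lam B rho (hist z a y t o)} ⊆ ⋃ k, E k := by
    intro o ho
    have h1 : rho ^ 2 * (2 * ℓ + D o) < Q o := by
      by_contra! hle
      refine ho (G.mem_confSet_of_le θ z a y hlam hB hrho t o ?_)
      rw [one_div_one_div, add_sub_assoc]
      exact hle
    have h2 : Filter.Tendsto (fun k : ℕ => (rho + 1 / ((k : ℝ) + 1)) ^ 2 * (2 * ℓ + D o))
        Filter.atTop (nhds ((rho + 0) ^ 2 * (2 * ℓ + D o))) :=
      ((tendsto_one_div_add_atTop_nhds_zero_nat.const_add rho).pow 2).mul_const _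
    rw [add_zero] at h2
    obtain ⟨k, hk⟩ := (h2.eventually_lt_const h1).exists
    exact Set.mem_iUnion.2 ⟨k, hk⟩
  refine (measure_mono hsub).trans ?_
  rw [hE.measure_iUnion]
  exact iSup_le fun k => hbad _ (by positivity) (le_add_of_nonneg_right (by positivity))

end Confidence

end ContextualGame

/-- The inequality between the regret and the information of one round that follows from optimality
against mixtures of a greedy and an exploring kernel. -/
theorem cube_le_of_ratio_bounds {X I q J D k x : ℝ} (hX : 0 ≤ X) (hI : 0 ≤ I) (hq : 0 ≤ q)
    (hJ : 0 ≤ J) (hD : 0 ≤ D) (hk : 0 ≤ k) (hqJ : q ^ 2 ≤ k * J) (h0 : q = 0 → X = 0)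
    (hhalf : X ^ 2 * (1 / 2 * I) ≤ (1 / 2 * X + 1 / 2 * q) ^ 2 * I)
    (hmix : ∀ p, 0 ≤ p → p ≤ 1 →
      X ^ 2 * (p * J) ≤ (p * (D + 4 * q) + (1 - p) * q) ^ 2 * I)
    (hx : 0 ≤ x) (hxX : x ≤ X) (hxD : x ≤ D) : x ^ 3 ≤ 64 * k * D * I := by
  have hrhs : 0 ≤ 64 * k * D * I := by positivity
  rcases hq.eq_or_lt with hq0 | hq
  · have : x = 0 := le_antisymm (hxX.trans (h0 hq0.symm).le) hx
    simpa [this] using hrhs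
  have hJ' : 0 < J := by
    rcases hJ.eq_or_lt with h | h
    · rw [← h] at hqJ
      nlinarith [pow_pos hq 2]
    · exact h
  have hfull := hmix 1 zero_le_one le_rfl
  rcases hI.eq_or_lt with hI0 | hI
  · rw [← hI0] at hfull
    have : X ^ 2 ≤ 0 := by
      by_contra! hlt
      nlinarith [mul_pos hlt hJ']
    have hX0 : X = 0 := by nlinarith
    have : x = 0 := le_antisymm (hxX.trans hX0.le) hx
    simpa [this] using hrhs
  -- Mixing with the greedy kernel by halves gives √2 X ≤ X + q, so X ≤ (1 + √2)q ≤ 5q/2.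
  have hXq : X ≤ 5 / 2 * q := by
    have h1 : X ^ 2 * (1 / 2) ≤ (1 / 2 * X + 1 / 2 * q) ^ 2 := by
      by_contra! hlt
      nlinarith [mul_lt_mul_of_pos_right hlt hI]
    by_contra! hlt
    nlinarith
  rcases le_or_gt D (4 * q) with hcase | hcase
  -- Large q: pure exploration (p = 1) suffices, since D + 4q ≤ 8q. The constant 64 = 8² comes from
  -- here.
  · have h1 : X ^ 2 ≤ 64 * k * I := by
      have h2 : X ^ 2 * J ≤ (64 * k * I) * J := by
        calc X ^ 2 * J ≤ (D + 4 * q) ^ 2 * I := by linarith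
          _ ≤ (8 * q) ^ 2 * I := by gcongr; linarith
          _ = 64 * q ^ 2 * I := by ring
          _ ≤ 64 * (k * J) * I := by gcongr
          _ = _ := by ring
      exact le_of_mul_le_mul_right h2 hJ'
    calc x ^ 3 = x ^ 2 * x := by ring
      _ ≤ X ^ 2 * D := by gcongr
      _ ≤ 64 * k * I * D := by gcongr
      _ = _ := by ring
  -- Small q: the weight p = q/(2D) keeps the mixed gap estimate below 2q. This case only needs the
  -- constant 20 = (5/2)·8.
  · have hDpos : 0 < D := by linarith
    have hp1 : q / (2 * D) ≤ 1 := by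
      rw [div_le_one (by positivity)]
      linarith
    have h1 := hmix (q / (2 * D)) (by positivity) hp1
    have h2 : q / (2 * D) * (D + 4 * q) + (1 - q / (2 * D)) * q ≤ 2 * q := by
      have h3 : q / (2 * D) * (D + 4 * q) ≤ q / (2 * D) * (2 * D) := by gcongr; linarith
      have h4 : q / (2 * D) * (2 * D) = q := by field_simp
      have h5 : 0 ≤ q / (2 * D) * q := by positivity
      linarith
    have h2' : 0 ≤ q / (2 * D) * (D + 4 * q) + (1 - q / (2 * D)) * q := by
      have : 0 ≤ 1 - q / (2 * D) := by linarith
      positivity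
    have h6 : X ^ 2 * (q / (2 * D) * J) ≤ (2 * q) ^ 2 * I :=
      h1.trans (by gcongr)
    have h7 : X ^ 2 * J ≤ 8 * q * D * I := by
      have h8 : X ^ 2 * (q / (2 * D) * J) * (2 * D) = X ^ 2 * J * q := by field_simp
      have h9 := mul_le_mul_of_nonneg_right h6 (by positivity : 0 ≤ 2 * D)
      rw [h8] at h9
      refine le_of_mul_le_mul_right ?_ hq
      linarith
    have h10 : X ^ 2 * q ≤ 8 * k * D * I := by
      refine le_of_mul_le_mul_right ?_ (mul_pos hq hJ')
      calc X ^ 2 * q * (q * J) = q ^ 2 * (X ^ 2 * J) := by ring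
        _ ≤ (k * J) * (8 * q * D * I) := by gcongr
        _ = _ := by ring
    calc x ^ 3 ≤ X ^ 3 := by gcongr
      _ = X ^ 2 * X := by ring
      _ ≤ X ^ 2 * (5 / 2 * q) := by gcongr
      _ = 5 / 2 * (X ^ 2 * q) := by ring
      _ ≤ 5 / 2 * (8 * k * D * I) := by gcongr
      _ ≤ 64 * k * D * I := by
        have : 0 ≤ k * D * I := by positivity
        linarith

namespace ContextualGame

variable {Z A : Type*} [MeasurableSpace Z] [TopologicalSpace A] {d m : ℕ}

/-! ### Gap estimates -/

section GapEst

variable (G : ContextualGame Z A d m) {lam B rho : ℝ} {t : ℕ} {h : History Z A m t}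
  {R : Matrix (Fin d) (Fin d) ℝ} (hVR : G.gram lam h = R.transpose * R) (hR : IsUnit R.det)
  (hB : 0 ≤ B) (hrho : 0 ≤ rho)

include hVR hB hrho in
theorem mem_confSet_iff (θ : Vec d) : θ ∈ G.confSet lam B rho h ↔
    ‖app R (θ - G.thetaHat lam h)‖ ≤ G.radius h lam B rho := by
  rw [confSet, Set.mem_ofPred_eq, ← norm_app_factor_sq hVR, beta_eq]
  exact pow_le_pow_iff_left₀ (norm_nonneg _) (G.radius_nonneg h hB hrho) two_ne_zero

include hVR hR hB hrho in
theorem inner_le_of_mem_confSet {θ : Vec d} (hθ : θ ∈ G.confSet lam B rho h) (v : Vec d) :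
    inner ℝ v θ ≤ inner ℝ v (G.thetaHat lam h) +
      G.radius h lam B rho * ‖app R⁻¹.transpose v‖ := by
  have h1 := inner_le_norm_factor hR v (θ - G.thetaHat lam h)
  rw [inner_sub_right] at h1
  have h2 := (G.mem_confSet_iff hVR hB hrho θ).1 hθ
  have h3 := mul_le_mul_of_nonneg_left h2 (norm_nonneg (app R⁻¹.transpose v))
  linarith

include hVR hR hB hrho in
theorem inner_le_inner_of_mem_confSet {θ θ' : Vec d} (hθ : θ ∈ G.confSet lam B rho h)
    (hθ' : θ' ∈ G.confSet lam B rho h) (v : Vec d) :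
    inner ℝ v θ' ≤ inner ℝ v θ + 2 * G.radius h lam B rho * ‖app R⁻¹.transpose v‖ := by
  have h1 := G.inner_le_of_mem_confSet hVR hR hB hrho hθ' v
  have h2 := G.inner_le_of_mem_confSet hVR hR hB hrho hθ (-v)
  rw [inner_neg_left, inner_neg_left, ← appL_apply, map_neg, norm_neg, appL_apply] at h2
  linarith

variable (hfeat : ∀ x, ∀ b ∈ G.avail x, ∀ c ∈ G.avail x, ‖G.feat x b - G.feat x c‖ ≤ 1)

include hVR hR hB hrho hfeat in
theorem gap_le_gapEst (hlam : 0 < lam) {θ : Vec d} (hθ : θ ∈ G.confSet lam B rho h) {z : Z} {a : A}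
    (ha : a ∈ G.avail z) : G.gap θ a z ≤ G.gapEst lam B rho h a z := by
  -- Boundedness matters: the real supremum of an unbounded set is 0, which would not dominate the
  -- gap.
  have hbdd : BddAbove {r | ∃ b ∈ G.avail z, ∃ θ ∈ G.confSet lam B rho h,
      r = inner ℝ (G.feat z b - G.feat z a) θ} := by
    refine ⟨‖θ‖ + 2 * G.radius h lam B rho * (1 / √lam), ?_⟩
    rintro r ⟨b, hb, θ', hθ', rfl⟩
    refine (G.inner_le_inner_of_mem_confSet hVR hR hB hrho hθ hθ' _).trans ?_
    have h1 := sqrt_mul_norm_factor_inv_le hR (G.mul_norm_sq_le_factor h hVR)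
      (G.feat z b - G.feat z a)
    have h2 := h1.trans (hfeat z b hb a ha)
    rw [mul_comm, ← le_div_iff₀ (Real.sqrt_pos.2 hlam)] at h2
    have h3 := G.radius_nonneg h (lam := lam) hB hrho
    have h4 := G.inner_feat_sub_le θ hfeat ha hb
    gcongr
  refine csSup_le ⟨_, a, ha, rfl⟩ ?_
  rintro r ⟨b, hb, rfl⟩
  exact le_csSup hbdd ⟨b, hb, θ, hθ, rfl⟩

include hVR hR hB hrho hfeat in
-- Two plausible parameters are at V-distance at most twice the radius, hence the factor 2.
theorem gapEst_le_maxGap_add [Nonempty Z] {θ : Vec d} (hθ : θ ∈ G.confSet lam B rho h) {z : Z}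
    {a : A} (ha : a ∈ G.avail z) {r : ℝ} (hr0 : 0 ≤ r)
    (hr : ∀ b ∈ G.avail z, ‖app R⁻¹.transpose (G.feat z b - G.feat z a)‖ ≤ r) :
    G.gapEst lam B rho h a z ≤ G.maxGap θ + 2 * G.radius h lam B rho * r := by
  have h3 := G.radius_nonneg h (lam := lam) hB hrho
  have h4 := G.maxGap_nonneg (θ := θ) hfeat
  refine Real.sSup_le ?_ (by positivity)
  rintro _ ⟨b, hb, θ', hθ', rfl⟩
  refine (G.inner_le_inner_of_mem_confSet hVR hR hB hrho hθ hθ' _).trans ?_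
  have h5 := G.le_maxGap (θ := θ) hfeat ha hb
  have h6 := hr b hb
  gcongr

include hVR hR hB hrho in
-- At the centre of the confidence set a greedy action has no gap, so only one radius is paid.
theorem gapEst_le_of_greedy {z : Z} {a : A}
    (ha : ∀ b ∈ G.avail z, inner ℝ (G.feat z b) (G.thetaHat lam h) ≤
      inner ℝ (G.feat z a) (G.thetaHat lam h)) {r : ℝ} (hr0 : 0 ≤ r)
    (hr : ∀ b ∈ G.avail z, ‖app R⁻¹.transpose (G.feat z b - G.feat z a)‖ ≤ r) :
    G.gapEst lam B rho h a z ≤ G.radius h lam B rho * r := by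
  have h3 := G.radius_nonneg h (lam := lam) hB hrho
  refine Real.sSup_le ?_ (by positivity)
  rintro _ ⟨b, hb, θ', hθ', rfl⟩
  refine (G.inner_le_of_mem_confSet hVR hR hB hrho hθ' _).trans ?_
  have h5 := ha b hb
  have h6 := mul_le_mul_of_nonneg_left (hr b hb) h3
  rw [inner_sub_left]
  linarith

include hR in
/-- The actions whose features are farthest from a given point, in the norm of the inverse of the
Gram matrix, are Pareto optimal. -/
theorem mem_pareto_of_farthest {z : Z} {a : A} (ha : a ∈ G.avail z) (x : Vec d)
    (hmax : ∀ b ∈ G.avail z, ‖app R⁻¹.transpose (G.feat z b - x)‖ ≤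
      ‖app R⁻¹.transpose (G.feat z a - x)‖) : a ∈ G.pareto z := by
  set q := app R⁻¹.transpose (G.feat z a - x)
  have hinner : ∀ b, inner ℝ (G.feat z b) (app R⁻¹ q) =
      inner ℝ (app R⁻¹.transpose (G.feat z b - x)) q + inner ℝ (app R⁻¹.transpose x) q := by
    intro b
    rw [← inner_add_left, ← app_add, sub_add_cancel, inner_app_left, Matrix.transpose_transpose]
  have hinner_a := hinner a
  rw [show app R⁻¹.transpose (G.feat z a - x) = q from rfl, real_inner_self_eq_norm_sq] at hinner_a
  have hle : ∀ b ∈ G.avail z, inner ℝ (app R⁻¹.transpose (G.feat z b - x)) q ≤ ‖q‖ ^ 2 := by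
    intro b hb
    refine (real_inner_le_norm _ _).trans ?_
    rw [sq]
    exact mul_le_mul_of_nonneg_right (hmax b hb) (norm_nonneg _)
  -- The witness is the direction from x to the feature of a, transported by R. Cauchy–Schwarz makes
  -- a optimal for it. For another optimal b, expanding ‖R⁻ᵀ(φ_b - x) - q‖² gives at most 0, so b is
  -- a duplicate.
  refine ⟨ha, app R⁻¹ q, fun b hb => ?_, fun b hb he => ?_⟩
  · rw [hinner b, hinner_a]
    linarith [hle b hb]
  · rw [hinner b, hinner_a] at he
    have h1 : ‖app R⁻¹.transpose (G.feat z b - x) - q‖ ^ 2 ≤ 0 := by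
      have h2 := pow_le_pow_left₀ (norm_nonneg _) (hmax b hb) 2
      rw [norm_sub_sq_real]
      linarith
    have h2 : app R⁻¹.transpose (G.feat z b - x) - q = 0 := by
      rw [← norm_eq_zero]
      exact pow_eq_zero_iff two_ne_zero |>.1 (le_antisymm h1 (sq_nonneg _))
    have h3 : app R⁻¹.transpose (G.feat z b - G.feat z a) = 0 := by
      rw [← h2, ← app_sub]
      congr 1
      abel
    have h4 := congrArg (app R.transpose) h3
    rw [← app_mul, ← Matrix.transpose_mul, Matrix.nonsing_inv_mul _ hR, Matrix.transpose_one,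
      app_one, app_zero] at h4
    exact sub_eq_zero.1 h4

end GapEst

end ContextualGame

/-! ### Mixtures of kernels -/

/-- The mixture of two kernels with weights `p` and `q`. -/
def mixKernel {Z A : Type*} [MeasurableSpace Z] [MeasurableSpace A] (p q : ℝ≥0∞)
    (κ η : Kernel Z A) : Kernel Z A where
  toFun z := p • κ z + q • η z
  measurable' := Measure.measurable_of_measurable_coe _ fun s hs => by
    simp only [Measure.coe_add, Measure.coe_smul, Pi.add_apply, Pi.smul_apply, smul_eq_mul]
    exact ((κ.measurable_coe hs).const_mul p).add ((η.measurable_coe hs).const_mul q)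

theorem mixKernel_apply {Z A : Type*} [MeasurableSpace Z] [MeasurableSpace A] (p q : ℝ≥0∞)
    (κ η : Kernel Z A) (z : Z) : mixKernel p q κ η z = p • κ z + q • η z := rfl

theorem lintegral_mixKernel {Z A : Type*} [MeasurableSpace Z] [MeasurableSpace A] (p q : ℝ≥0∞)
    (κ η : Kernel Z A) (z : Z) (f : A → ℝ≥0∞) :
    ∫⁻ a, f a ∂(mixKernel p q κ η z) = p * ∫⁻ a, f a ∂(κ z) + q * ∫⁻ a, f a ∂(η z) := by
  rw [mixKernel_apply, lintegral_add_measure, lintegral_smul_measure, lintegral_smul_measure]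
  rfl

namespace ContextualGame

variable {Z A : Type*} [MeasurableSpace Z] [TopologicalSpace A] [MeasurableSpace A] {d m : ℕ}
  (G : ContextualGame Z A d m) {lam B rho : ℝ} {t : ℕ} (h : History Z A m t) (χ : Measure Z)

theorem mixKernel_mem_kernels {p q : ℝ≥0∞} (hpq : p + q = 1) {κ η : Kernel Z A}
    (hκ : κ ∈ G.Kernels) (hη : η ∈ G.Kernels) : mixKernel p q κ η ∈ G.Kernels := by
  have := hκ.1
  have := hη.1
  refine ⟨⟨fun z => ⟨?_⟩⟩, fun z => ?_⟩
  · rw [mixKernel_apply]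
    simp [hpq]
  · rw [mixKernel_apply]
    simp [hκ.2 z, hη.2 z]

theorem deterministic_mem_kernels [MeasurableSingletonClass A] {c : Z → A} (hc : Measurable c)
    (hcav : ∀ z, c z ∈ G.avail z) (hm : ∀ z, MeasurableSet (G.avail z)) :
    Kernel.deterministic c hc ∈ G.Kernels := by
  refine ⟨inferInstance, fun z => ?_⟩
  rw [Kernel.deterministic_apply' _ _ (hm z).compl]
  simp [hcav z]

variable {h χ} in
-- Additivity of the Lebesgue integral needs one measurable summand. The measurable majorant g plays
-- that part, so measurability of the gap estimate is not needed.
theorem gapEstAvg_mixKernel_le (p q : ℝ≥0∞) (hp : p ≠ ∞) (hq : q ≠ ∞) (κ η : Kernel Z A)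
    {g : Z → ℝ≥0∞} (hg : Measurable g)
    (hle : ∀ z, ∫⁻ a, ENNReal.ofReal (G.gapEst lam B rho h a z) ∂(η z) ≤ g z) :
    G.gapEstAvg lam B rho χ h (mixKernel p q κ η) ≤
      p * G.gapEstAvg lam B rho χ h κ + q * ∫⁻ z, g z ∂χ := by
  unfold gapEstAvg
  simp only [lintegral_mixKernel]
  rw [← lintegral_const_mul' p _ hp, ← lintegral_const_mul' q _ hq,
    ← lintegral_add_right _ (hg.const_mul q)]
  gcongr with z
  exact hle z

variable {h χ} in
theorem le_infoGainAvg_mixKernel (p q : ℝ≥0∞) (hp : p ≠ ∞) (κ η : Kernel Z A) :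
    p * G.infoGainAvg lam χ h κ ≤ G.infoGainAvg lam χ h (mixKernel p q κ η) := by
  unfold infoGainAvg
  simp only [lintegral_mixKernel]
  rw [← lintegral_const_mul' p _ hp]
  gcongr with z
  exact le_self_add

theorem lintegral_le_of_mem_kernels [IsProbabilityMeasure χ] {ξ : Kernel Z A} (hξ : ξ ∈ G.Kernels)
    {f : Z → A → ℝ≥0∞} {C : ℝ≥0∞} (hf : ∀ z, ∀ a ∈ G.avail z, f z a ≤ C) :
    ∫⁻ z, ∫⁻ a, f z a ∂(ξ z) ∂χ ≤ C := by
  have := hξ.1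
  calc ∫⁻ z, ∫⁻ a, f z a ∂(ξ z) ∂χ ≤ ∫⁻ z, ∫⁻ _, C ∂(ξ z) ∂χ :=
        lintegral_mono fun z => lintegral_mono_ae <| by
          filter_upwards [mem_ae_iff.2 (hξ.2 z)] with a ha using hf z a ha
    _ = C := by simp

theorem infoGainAvg_le [IsProbabilityMeasure χ] (hlam : 0 < lam) {L : ℝ} (hL : L ^ 2 ≤ lam)
    (hobs : ∀ x, ∀ b ∈ G.avail x, ∀ v, ‖app (G.obs x b) v‖ ≤ L * ‖v‖) {ξ : Kernel Z A}
    (hξ : ξ ∈ G.Kernels) : G.infoGainAvg lam χ h ξ ≤ ENNReal.ofReal (d / 2) :=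
  G.lintegral_le_of_mem_kernels χ hξ fun z a ha =>
    ENNReal.ofReal_le_ofReal (G.infoGain_le h hlam hL (hobs z a ha))

/-! ### The alignment constant and exploration -/

/-- The infimum over c need not be attained; a constant strictly above the alignment constant makes
one selection suffice. -/
theorem exists_selection_of_alignment_lt {α' : ℝ} (hα : G.alignment χ < ENNReal.ofReal α')
    {ω : Z → Vec d} (hω : Measurable ω) (hωi : Integrable ω χ) {a b : Z → A}
    (ha : a ∈ G.ParetoSelections) (hb : b ∈ G.ParetoSelections) :
    ∃ c ∈ G.Selections,
      ENNReal.ofReal ((∫ z, inner ℝ (G.feat z (a z) - G.feat z (b z)) (ω z) ∂χ) ^ 2) ≤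
        ENNReal.ofReal α' *
          ∫⁻ z', ∫⁻ z, ENNReal.ofReal (‖app (G.obs z' (c z')) (ω z)‖ ^ 2) ∂χ ∂χ := by
  have h1 : (⨅ c ∈ G.Selections,
      ENNReal.ofReal ((∫ z, inner ℝ (G.feat z (a z) - G.feat z (b z)) (ω z) ∂χ) ^ 2) /
        ∫⁻ z', ∫⁻ z, ENNReal.ofReal (‖app (G.obs z' (c z')) (ω z)‖ ^ 2) ∂χ ∂χ) ≤
      G.alignment χ := by
    unfold alignment
    exact le_iSup_of_le ω <| le_iSup_of_le hω <| le_iSup_of_le hωi <| le_iSup_of_le a <|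
      le_iSup_of_le ha <| le_iSup_of_le b <| le_iSup_of_le hb le_rfl
  have h2 := h1.trans_lt hα
  simp only [iInf_lt_iff] at h2
  obtain ⟨c, hc, h3⟩ := h2
  refine ⟨c, hc, (ENNReal.div_le_iff_le_mul (Or.inr ENNReal.ofReal_ne_top)
    (Or.inr fun h0 => ?_)).1 h3.le⟩
  rw [h0] at h3
  exact not_lt_zero h3

variable {h}

/-- Apply the alignment constant to the direction of V-norm at most one that realises ‖φ_a - φ_b‖ in
the dual norm; the denominator is then bounded by information. -/
theorem exists_selection_sq_integral_le [CompactSpace A] [TopologicalSpace.MetrizableSpace A]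
    [BorelSpace A] [IsProbabilityMeasure χ] (hlam : 0 < lam) {L : ℝ} (hL : L ^ 2 ≤ lam)
    (hobs : ∀ x, ∀ b ∈ G.avail x, ∀ v, ‖app (G.obs x b) v‖ ≤ L * ‖v‖)
    {R : Matrix (Fin d) (Fin d) ℝ} (hVR : G.gram lam h = R.transpose * R) (hR : IsUnit R.det)
    {α' : ℝ} (hα : G.alignment χ < ENNReal.ofReal α') {a b : Z → A}
    (ha : a ∈ G.ParetoSelections) (hb : b ∈ G.ParetoSelections) :
    ∃ c ∈ G.Selections, ENNReal.ofReal
      ((∫ z, ‖app R⁻¹.transpose (G.feat z (a z) - G.feat z (b z))‖ ∂χ) ^ 2) ≤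
        ENNReal.ofReal α' *
          (4 * ∫⁻ z, ENNReal.ofReal (G.infoGain lam h (c z) z) ∂χ) := by
  let v : Z → Vec d := fun z => G.feat z (a z) - G.feat z (b z)
  let T : Z → Vec d := fun z => app R⁻¹.transpose (v z)
  -- Where T vanishes, the convention 0⁻¹ = 0 gives ω = 0, and ⟨v, ω⟩ = ‖T‖ still holds.
  let ω : Z → Vec d := fun z => ‖T z‖⁻¹ • app R⁻¹ (T z)
  have hv : Measurable v :=
    (G.measurable_feat.comp (measurable_id.prodMk ha.1)).sub
      (G.measurable_feat.comp (measurable_id.prodMk hb.1))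
  have hT : Measurable T := (appL R⁻¹.transpose).continuous.measurable.comp hv
  have hω : Measurable ω := hT.norm.inv.smul ((appL R⁻¹).continuous.measurable.comp hT)
  have hRω : ∀ z, ‖app R (ω z)‖ ≤ 1 := fun z => by
    simp only [ω]
    rw [app_smul, app_factor_inv hR, norm_smul, norm_inv, norm_norm]
    exact inv_mul_le_one
  have hωb : ∀ z, ‖ω z‖ ≤ 1 / √lam := fun z => by
    have h1 := Real.sqrt_le_sqrt (G.mul_norm_sq_le_factor h hVR (ω z))
    rw [Real.sqrt_mul hlam.le, Real.sqrt_sq (norm_nonneg _), Real.sqrt_sq (norm_nonneg _)] at h1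
    rw [le_div_iff₀ (Real.sqrt_pos.2 hlam), mul_comm]
    exact h1.trans (hRω z)
  have hωi : Integrable ω χ :=
    Integrable.of_bound hω.aestronglyMeasurable _ (Filter.Eventually.of_forall hωb)
  have hinner : ∀ z, inner ℝ (v z) (ω z) = ‖T z‖ := fun z => by
    simp only [ω]
    rw [inner_smul_right, inner_app_right, real_inner_self_eq_norm_sq]
    rcases eq_or_ne ‖T z‖ 0 with h0 | h0
    · simp [h0]
    · field_simp
      rfl
  obtain ⟨c, hc, hle⟩ := G.exists_selection_of_alignment_lt χ hα hω hωi ha hb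
  refine ⟨c, hc, ?_⟩
  have h1 : ∫ z, inner ℝ (G.feat z (a z) - G.feat z (b z)) (ω z) ∂χ = ∫ z, ‖T z‖ ∂χ :=
    integral_congr_ae (Filter.Eventually.of_forall hinner)
  rw [h1] at hle
  refine hle.trans ?_
  gcongr
  rw [← lintegral_const_mul' 4 _ (by simp)]
  -- The information at z' bounds ‖Mω^z‖² for all z at once, so averaging over z costs nothing.
  refine lintegral_mono fun z' => ?_
  calc ∫⁻ z, ENNReal.ofReal (‖app (G.obs z' (c z')) (ω z)‖ ^ 2) ∂χ
      ≤ ∫⁻ _, ENNReal.ofReal (4 * G.infoGain lam h (c z') z') ∂χ :=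
        lintegral_mono fun z => ENNReal.ofReal_le_ofReal
          (G.norm_app_sq_le_infoGain h hVR hR hL (hobs z' _ (hc.2 z')) (hRω z))
    _ = 4 * ENNReal.ofReal (G.infoGain lam h (c z') z') := by
        rw [lintegral_const, measure_univ, mul_one, ENNReal.ofReal_mul (by norm_num)]
        simp

end ContextualGame

/-! ### Regret against information in one round -/

theorem toReal_sq_mul_le_of_div_le {X I Y J : ℝ≥0∞} (hI : I ≠ ∞)
    (hle : X ^ 2 / I ≤ Y ^ 2 / J) {y j : ℝ} (hy : 0 ≤ y) (hj : 0 ≤ j) (hY : Y ≤ ENNReal.ofReal y)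
    (hJ : ENNReal.ofReal j ≤ J) : X.toReal ^ 2 * j ≤ y ^ 2 * I.toReal := by
  rcases hj.eq_or_lt with rfl | hj
  · simp only [mul_zero]
    positivity
  have h1 : X ^ 2 / I ≤ ENNReal.ofReal (y ^ 2 / j) := by
    rw [ENNReal.ofReal_div_of_pos hj, ENNReal.ofReal_pow hy]
    exact hle.trans (by gcongr)
  rw [ENNReal.div_le_iff_le_mul (Or.inr ENNReal.ofReal_ne_top) (Or.inl hI)] at h1
  have h2 := ENNReal.toReal_mono (ENNReal.mul_ne_top ENNReal.ofReal_ne_top hI) h1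
  rw [ENNReal.toReal_pow, ENNReal.toReal_mul, ENNReal.toReal_ofReal (by positivity),
    div_mul_eq_mul_div, le_div_iff₀ hj] at h2
  exact h2

namespace ContextualGame

variable {Z A : Type*} [MeasurableSpace Z] [TopologicalSpace A] [MeasurableSpace A] {d m : ℕ}
  {G : ContextualGame Z A d m} {lam B rho : ℝ} {t : ℕ} {h : History Z A m t} {χ : Measure Z}
  [CompactSpace A] [TopologicalSpace.MetrizableSpace A] [BorelSpace A]

variable (G) in
/-- Measurable selections of a greedy action and of two Pareto optimal actions that are far apart
in the norm of the inverse of the Gram matrix. -/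
theorem exists_greedy_and_pareto {R : Matrix (Fin d) (Fin d) ℝ} (hR : IsUnit R.det) (θ' : Vec d) :
    ∃ g a b : Z → A, Measurable g ∧ a ∈ G.ParetoSelections ∧ b ∈ G.ParetoSelections ∧
      (∀ z, g z ∈ G.avail z ∧ ∀ c ∈ G.avail z,
        inner ℝ (G.feat z c) θ' ≤ inner ℝ (G.feat z (g z)) θ') ∧
      (∀ z, ∀ c ∈ G.avail z, ‖app R⁻¹.transpose (G.feat z c - G.feat z (g z))‖ ≤
        ‖app R⁻¹.transpose (G.feat z (a z) - G.feat z (b z))‖) ∧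
      ∀ z, ∀ c ∈ G.avail z, ∀ e ∈ G.avail z, ‖app R⁻¹.transpose (G.feat z c - G.feat z e)‖ ≤
        2 * ‖app R⁻¹.transpose (G.feat z (a z) - G.feat z (b z))‖ := by
  have hsymm : ∀ v w : Vec d, ‖app R⁻¹.transpose (v - w)‖ = ‖app R⁻¹.transpose (w - v)‖ :=
    fun v w => by rw [app_sub, app_sub, norm_sub_rev]
  have hfar : ∀ x : Z → Vec d, Measurable x → ∃ c : Z → A, Measurable c ∧ ∀ z, c z ∈ G.avail z ∧
      ∀ e ∈ G.avail z, ‖app R⁻¹.transpose (G.feat z e - x z)‖ ≤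
        ‖app R⁻¹.transpose (G.feat z (c z) - x z)‖ := fun x hx =>
    exists_measurable_argmax G.avail_closed G.avail_nonempty G.avail_measurable
      (f := fun z e => ‖app R⁻¹.transpose (G.feat z e - x z)‖)
      (fun z => ((appL R⁻¹.transpose).continuous.comp
        ((G.feat_continuous z).sub continuous_const)).norm)
      (fun e => ((appL R⁻¹.transpose).continuous.measurable.comp
        ((G.feat_measurable e).sub hx)).norm)
  have hsel : ∀ c : Z → A, Measurable c → Measurable fun z => G.feat z (c z) := fun c hc =>
    G.measurable_feat.comp (measurable_id.prodMk hc)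
  obtain ⟨g, hgm, hg⟩ := exists_measurable_argmax G.avail_closed G.avail_nonempty
    G.avail_measurable (f := fun z e => inner ℝ (G.feat z e) θ')
    (fun z => by have := G.feat_continuous z; fun_prop)
    (fun e => (G.feat_measurable e).inner measurable_const)
  -- a is farthest from g and b farthest from a. Distances from g are thus at most ‖φ_a - φ_g‖ ≤
  -- ‖φ_a - φ_b‖, and any two features are within twice that by passing through a.
  obtain ⟨a, ham, ha⟩ := hfar _ (hsel g hgm)
  obtain ⟨b, hbm, hb⟩ := hfar _ (hsel a ham)
  have hab : ∀ z, ∀ c ∈ G.avail z, ‖app R⁻¹.transpose (G.feat z c - G.feat z (a z))‖ ≤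
      ‖app R⁻¹.transpose (G.feat z (a z) - G.feat z (b z))‖ := fun z c hc => by
    rw [hsymm (G.feat z (a z))]
    exact (hb z).2 c hc
  refine ⟨g, a, b, hgm, ⟨ham, fun z => ?_⟩, ⟨hbm, fun z => ?_⟩, hg, fun z c hc => ?_,
    fun z c hc e he => ?_⟩
  · exact G.mem_pareto_of_farthest hR (ha z).1 _ (ha z).2
  · exact G.mem_pareto_of_farthest hR (hb z).1 _ (hb z).2
  · refine ((ha z).2 c hc).trans ?_
    rw [hsymm]
    exact hab z (g z) (hg z).1
  · have h1 := hab z c hc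
    have h2 := hab z e he
    rw [hsymm] at h2
    have h3 : G.feat z c - G.feat z e =
        (G.feat z c - G.feat z (a z)) + (G.feat z (a z) - G.feat z e) := by abel
    rw [h3, app_add]
    refine (norm_add_le _ _).trans ?_
    linarith

/-- The regret and the information gain of contextual information-directed sampling in a round in
which the true parameter is plausible. -/
theorem IsContextualIDS.lintegral_gap_cube_le [IsProbabilityMeasure χ]
    {ξ : ∀ t : ℕ, Kernel (History Z A m t × Z) A} (hids : G.IsContextualIDS lam B rho χ ξ)
    {θ : Vec d} (hθ : θ ∈ G.confSet lam B rho h) (hB : 0 ≤ B) (hrho : 0 ≤ rho)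
    (hlam : 0 < lam) {L : ℝ} (hL : L ^ 2 ≤ lam)
    (hobs : ∀ x, ∀ b ∈ G.avail x, ∀ v, ‖app (G.obs x b) v‖ ≤ L * ‖v‖)
    (hfeat : ∀ x, ∀ b ∈ G.avail x, ∀ c ∈ G.avail x, ‖G.feat x b - G.feat x c‖ ≤ 1)
    {α' : ℝ} (hα0 : 0 ≤ α') (hα : G.alignment χ < ENNReal.ofReal α') :
    (∫⁻ z, ∫⁻ a, ENNReal.ofReal (G.gap θ a z) ∂(ξ t (h, z)) ∂χ) ^ 3 ≤
      ENNReal.ofReal (256 * α' * G.beta lam B rho h * G.maxGap θ) *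
        G.infoGainAvg lam χ h ((ξ t).sectR h) := by
  have hZ : Nonempty Z := nonempty_of_isProbabilityMeasure χ
  obtain ⟨R, hVR, hR⟩ := exists_transpose_mul_self (G.gram_posDef h hlam)
  have hav : ∀ z, MeasurableSet (G.avail z) := fun z => (G.avail_closed z).measurableSet
  obtain ⟨g, a, b, hgm, ha, hb, hg, hr1, hr2⟩ :=
    G.exists_greedy_and_pareto hR (G.thetaHat lam h)
  obtain ⟨c, hc, hcle⟩ := G.exists_selection_sq_integral_le χ hlam hL hobs hVR hR hα ha hb
  let r : Z → ℝ := fun z => ‖app R⁻¹.transpose (G.feat z (a z) - G.feat z (b z))‖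
  have hr0 : ∀ z, 0 ≤ r z := fun z => norm_nonneg _
  have hbound : ∀ z, ∀ e ∈ G.avail z, ∀ f ∈ G.avail z,
      ‖app R⁻¹.transpose (G.feat z e - G.feat z f)‖ ≤ 1 / √lam := by
    intro z e he f hf
    have h1 := sqrt_mul_norm_factor_inv_le hR (G.mul_norm_sq_le_factor h hVR)
      (G.feat z e - G.feat z f)
    rw [le_div_iff₀ (Real.sqrt_pos.2 hlam), mul_comm]
    exact h1.trans (hfeat z e he f hf)
  have hrm : Measurable r :=
    ((appL R⁻¹.transpose).continuous.measurable.comp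
      ((G.measurable_feat.comp (measurable_id.prodMk ha.1)).sub
        (G.measurable_feat.comp (measurable_id.prodMk hb.1)))).norm
  have hri : Integrable r χ := Integrable.of_bound hrm.aestronglyMeasurable (1 / √lam)
    (Filter.Eventually.of_forall fun z => by
      rw [Real.norm_of_nonneg (hr0 z)]
      exact hbound z _ (ha.2 z).1 _ (hb.2 z).1)
  set w := G.radius h lam B rho
  have hw : 0 ≤ w := G.radius_nonneg h hB hrho
  set D := G.maxGap θ
  have hD : 0 ≤ D := G.maxGap_nonneg hfeat
  set q := w * ∫ z, r z ∂χ
  have hq : 0 ≤ q := mul_nonneg hw (integral_nonneg hr0)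
  have hqint : ∫⁻ z, ENNReal.ofReal (w * r z) ∂χ = ENNReal.ofReal q := by
    rw [← ofReal_integral_eq_lintegral_ofReal (hri.const_mul w)
      (Filter.Eventually.of_forall fun z => mul_nonneg hw (hr0 z)), integral_const_mul]
  have hqint' : ∫⁻ z, ENNReal.ofReal (D + 4 * (w * r z)) ∂χ = ENNReal.ofReal (D + 4 * q) := by
    have h4 : Integrable (fun z => 4 * (w * r z)) χ := (hri.const_mul w).const_mul 4
    have h5 : Integrable (fun z => D + 4 * (w * r z)) χ := (integrable_const D).add h4
    rw [← ofReal_integral_eq_lintegral_ofReal h5 (Filter.Eventually.of_forall fun z =>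
      add_nonneg hD (mul_nonneg zero_le_four (mul_nonneg hw (hr0 z)))),
      integral_add (integrable_const D) h4, integral_const_mul, integral_const_mul]
    simp [q]
  let κg : Kernel Z A := Kernel.deterministic g hgm
  let κc : Kernel Z A := Kernel.deterministic c hc.1
  have hκg : κg ∈ G.Kernels := G.deterministic_mem_kernels hgm (fun z => (hg z).1) hav
  have hκc : κc ∈ G.Kernels := G.deterministic_mem_kernels hc.1 hc.2 hav
  have hgreedy : ∀ z, ∫⁻ a, ENNReal.ofReal (G.gapEst lam B rho h a z) ∂(κg z) ≤
      ENNReal.ofReal (w * r z) := fun z => by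
    rw [Kernel.lintegral_deterministic]
    exact ENNReal.ofReal_le_ofReal
      (G.gapEst_le_of_greedy hVR hR hB hrho (hg z).2 (hr0 z) (hr1 z))
  have hexplore : G.gapEstAvg lam B rho χ h κc ≤ ENNReal.ofReal (D + 4 * q) := by
    rw [← hqint']
    refine lintegral_mono fun z => ?_
    simp only [κc]
    rw [Kernel.lintegral_deterministic]
    refine ENNReal.ofReal_le_ofReal ?_
    -- Feature differences are at most 2r and plausible parameters at most 2w apart, whence the 4 in
    -- D + 4q.
    have h1 := G.gapEst_le_maxGap_add hVR hR hB hrho hfeat hθ (hc.2 z)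
      (r := 2 * r z) (by have := hr0 z; positivity) fun e he => hr2 z e he _ (hc.2 z)
    linarith
  set ζ := (ξ t).sectR h
  have hζ : ζ ∈ G.Kernels := hids.mem_kernels t h
  have hmin : ∀ η ∈ G.Kernels, (G.gapEstAvg lam B rho χ h ζ) ^ 2 / G.infoGainAvg lam χ h ζ ≤
      (G.gapEstAvg lam B rho χ h η) ^ 2 / G.infoGainAvg lam χ h η :=
    fun η hη => hids.isMin t h hη
  have hIfin : ∀ η ∈ G.Kernels, G.infoGainAvg lam χ h η ≠ ∞ := fun η hη =>
    ((G.infoGainAvg_le h χ hlam hL hobs hη).trans_lt ENNReal.ofReal_lt_top).ne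
  have hXfin : G.gapEstAvg lam B rho χ h ζ ≠ ∞ := by
    refine ((G.lintegral_le_of_mem_kernels χ hζ (C := ENNReal.ofReal (D + 2 * w * (1 / √lam)))
      fun z e he => ENNReal.ofReal_le_ofReal ?_).trans_lt ENNReal.ofReal_lt_top).ne
    exact G.gapEst_le_maxGap_add hVR hR hB hrho hfeat hθ he (by positivity)
      fun f hf => hbound z f hf e he
  set X := (G.gapEstAvg lam B rho χ h ζ).toReal
  set I := (G.infoGainAvg lam χ h ζ).toReal
  set J := (G.infoGainAvg lam χ h κc).toReal
  have hXeq : G.gapEstAvg lam B rho χ h ζ = ENNReal.ofReal X := (ENNReal.ofReal_toReal hXfin).symm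
  have hIeq : G.infoGainAvg lam χ h ζ = ENNReal.ofReal I :=
    (ENNReal.ofReal_toReal (hIfin ζ hζ)).symm
  have hJeq : G.infoGainAvg lam χ h κc = ENNReal.ofReal J :=
    (ENNReal.ofReal_toReal (hIfin κc hκc)).symm
  have hX0 : 0 ≤ X := ENNReal.toReal_nonneg
  have hI0 : 0 ≤ I := ENNReal.toReal_nonneg
  have hJ0 : 0 ≤ J := ENNReal.toReal_nonneg
  have hqJ : q ^ 2 ≤ 4 * α' * w ^ 2 * J := by
    have h1 : ∫⁻ z, ENNReal.ofReal (G.infoGain lam h (c z) z) ∂χ = ENNReal.ofReal J := by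
      rw [← hJeq]
      refine lintegral_congr fun z => ?_
      simp only [κc]
      rw [Kernel.lintegral_deterministic]
    have h4 : (4 : ℝ≥0∞) = ENNReal.ofReal 4 := by simp
    rw [h1, h4, ← ENNReal.ofReal_mul (by norm_num), ← ENNReal.ofReal_mul hα0,
      ENNReal.ofReal_le_ofReal_iff (by positivity)] at hcle
    calc q ^ 2 = w ^ 2 * (∫ z, r z ∂χ) ^ 2 := by ring
      _ ≤ w ^ 2 * (α' * (4 * J)) := by gcongr
      _ = _ := by ring
  -- Then the greedy kernel has ratio 0, by the convention 0/0 = 0 even without information, and so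
  -- has the minimiser. As its information is finite, its gap estimate vanishes.
  have hzero : q = 0 → X = 0 := by
    intro h0
    have h1 : G.gapEstAvg lam B rho χ h κg = 0 := by
      refine le_antisymm ((lintegral_mono hgreedy).trans ?_) zero_le
      rw [hqint, h0, ENNReal.ofReal_zero]
    have h2 := hmin κg hκg
    rw [h1, zero_pow two_ne_zero, ENNReal.zero_div, nonpos_iff_eq_zero,
      ENNReal.div_eq_zero_iff] at h2
    rcases h2 with h2 | h2
    · simp only [X]
      rw [pow_eq_zero_iff two_ne_zero] at h2
      rw [h2, ENNReal.toReal_zero]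
    · exact absurd h2 (hIfin ζ hζ)
  -- Optimality against mixtures with the greedy kernel, used for the IDS kernel itself at p = ½ and
  -- for the exploring kernel at every p.
  have hmixbd : ∀ p, 0 ≤ p → p ≤ 1 → ∀ η ∈ G.Kernels, ∀ y i : ℝ, 0 ≤ y → 0 ≤ i →
      G.gapEstAvg lam B rho χ h η ≤ ENNReal.ofReal y →
      G.infoGainAvg lam χ h η = ENNReal.ofReal i →
      X ^ 2 * (p * i) ≤ (p * y + (1 - p) * q) ^ 2 * I := by
    intro p hp0 hp1 η hη y i hy hi hY hI
    have hp1' : 0 ≤ 1 - p := sub_nonneg.2 hp1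
    have hpq : ENNReal.ofReal p + ENNReal.ofReal (1 - p) = 1 := by
      rw [← ENNReal.ofReal_add hp0 hp1']
      simp
    refine toReal_sq_mul_le_of_div_le (hIfin ζ hζ)
      (hmin _ (G.mixKernel_mem_kernels hpq hη hκg)) (by positivity) (by positivity) ?_ ?_
    · refine (G.gapEstAvg_mixKernel_le _ _ ENNReal.ofReal_ne_top ENNReal.ofReal_ne_top η κg
        (ENNReal.measurable_ofReal.comp (hrm.const_mul w)) hgreedy).trans ?_
      rw [ENNReal.ofReal_add (by positivity) (by positivity), ENNReal.ofReal_mul hp0,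
        ENNReal.ofReal_mul hp1']
      simp only [Function.comp_apply]
      rw [hqint]
      gcongr
    · rw [ENNReal.ofReal_mul hp0, ← hI]
      exact G.le_infoGainAvg_mixKernel _ _ ENNReal.ofReal_ne_top η κg
  have hxX : ∫⁻ z, ∫⁻ a, ENNReal.ofReal (G.gap θ a z) ∂(ξ t (h, z)) ∂χ ≤ ENNReal.ofReal X := by
    rw [← hXeq]
    refine lintegral_mono fun z => lintegral_mono_ae ?_
    have h1 : ξ t (h, z) (G.avail z)ᶜ = 0 := hζ.2 z
    filter_upwards [mem_ae_iff.2 h1] with e he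
    exact ENNReal.ofReal_le_ofReal (G.gap_le_gapEst hVR hR hB hrho hfeat hlam hθ he)
  have hxD : ∫⁻ z, ∫⁻ a, ENNReal.ofReal (G.gap θ a z) ∂(ξ t (h, z)) ∂χ ≤ ENNReal.ofReal D :=
    G.lintegral_le_of_mem_kernels χ hζ fun z e he =>
      ENNReal.ofReal_le_ofReal (G.gap_le_maxGap hfeat he)
  obtain ⟨x, hx0, hx⟩ : ∃ x : ℝ, 0 ≤ x ∧
      ∫⁻ z, ∫⁻ a, ENNReal.ofReal (G.gap θ a z) ∂(ξ t (h, z)) ∂χ = ENNReal.ofReal x :=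
    ⟨_, ENNReal.toReal_nonneg,
      (ENNReal.ofReal_toReal (hxX.trans_lt ENNReal.ofReal_lt_top).ne).symm⟩
  rw [hx] at hxX hxD ⊢
  rw [ENNReal.ofReal_le_ofReal_iff hX0] at hxX
  rw [ENNReal.ofReal_le_ofReal_iff hD] at hxD
  rw [hIeq, ← ENNReal.ofReal_pow hx0, ← ENNReal.ofReal_mul (by
    have := G.beta_nonneg h lam B rho
    positivity)]
  refine ENNReal.ofReal_le_ofReal ?_
  have hfinal := cube_le_of_ratio_bounds hX0 hI0 hq hJ0 hD
    (by positivity : 0 ≤ 4 * α' * w ^ 2) hqJ hzero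
    (by
      have := hmixbd (1 / 2) (by norm_num) (by norm_num) ζ hζ X I hX0 hI0 hXeq.le hIeq
      norm_num at this ⊢
      exact this)
    (fun p hp0 hp1 => hmixbd p hp0 hp1 κc hκc (D + 4 * q) J (by positivity) hJ0 hexplore hJeq)
    hx0 hxX hxD
  rw [beta_eq]
  calc x ^ 3 ≤ 64 * (4 * α' * w ^ 2) * D * I := hfinal
    _ = _ := by ring

end ContextualGame

/-! ### Expectation and summation over the rounds -/

theorem sum_inv_sq_le_two (n : ℕ) : ∑ t ∈ Finset.range n, 1 / ((t : ℝ) + 1) ^ 2 ≤ 2 := by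
  have key : ∀ n : ℕ, ∑ t ∈ Finset.range (n + 1), 1 / ((t : ℝ) + 1) ^ 2 ≤ 2 - 1 / ((n : ℝ) + 1) := by
    intro n
    induction n with
    | zero => norm_num
    | succ n ih =>
      rw [Finset.sum_range_succ]
      have h1 : 1 / (((n + 1 : ℕ) : ℝ) + 1) ^ 2 ≤
          1 / ((n : ℝ) + 1) - 1 / (((n + 1 : ℕ) : ℝ) + 1) := by
        push_cast
        rw [div_sub_div _ _ (by positivity) (by positivity), div_le_div_iff₀ (by positivity)
          (by positivity)]
        nlinarith [(Nat.cast_nonneg n : (0 : ℝ) ≤ n)]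
      linarith
  rcases n with _ | n
  · simp
  · refine (key n).trans ?_
    have : (0 : ℝ) ≤ 1 / ((n : ℝ) + 1) := by positivity
    linarith

/-- The power mean inequality with exponent 3; this is the source of n^(2/3). -/
theorem sum_cbrt_le (n : ℕ) {c : ℕ → ℝ} (hc : ∀ t, 0 ≤ c t) :
    ∑ t ∈ Finset.range n, c t ^ (1 / 3 : ℝ) ≤
      (n : ℝ) ^ (2 / 3 : ℝ) * (∑ t ∈ Finset.range n, c t) ^ (1 / 3 : ℝ) := by
  have h1 := Real.rpow_sum_le_const_mul_sum_rpow (Finset.range n) (fun t => c t ^ (1 / 3 : ℝ))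
    (p := 3) (by norm_num)
  have h2 : ∀ t, |c t ^ (1 / 3 : ℝ)| = c t ^ (1 / 3 : ℝ) := fun t =>
    abs_of_nonneg (Real.rpow_nonneg (hc t) _)
  have h3 : ∀ t, (c t ^ (1 / 3 : ℝ)) ^ (3 : ℝ) = c t := fun t => by
    rw [← Real.rpow_mul (hc t)]
    norm_num
  simp only [h2, h3, Finset.card_range] at h1
  have h0 : 0 ≤ ∑ t ∈ Finset.range n, c t ^ (1 / 3 : ℝ) :=
    Finset.sum_nonneg fun t _ => Real.rpow_nonneg (hc t) _
  have h4 := Real.rpow_le_rpow (Real.rpow_nonneg h0 _) h1 (by norm_num : (0 : ℝ) ≤ 1 / 3)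
  rw [← Real.rpow_mul h0, Real.mul_rpow (by positivity) (Finset.sum_nonneg fun t _ => hc t),
    ← Real.rpow_mul (Nat.cast_nonneg n)] at h4
  norm_num at h4 ⊢
  exact h4

namespace ContextualGame

variable {Z A : Type*} [MeasurableSpace Z] [TopologicalSpace A] [MeasurableSpace A] {d m : ℕ}
  {G : ContextualGame Z A d m} {lam B rho : ℝ} {χ : Measure Z}
  {Ω : Type*} [MeasurableSpace Ω] {P : Measure Ω}
  {θ : Vec d} {ξ : ∀ t : ℕ, Kernel (History Z A m t × Z) A} {n : ℕ}
  {z : ℕ → Ω → Z} {a : ℕ → Ω → A} {y : ℕ → Ω → Vec m}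

theorem IsInteraction.measurable_triple (hI : G.IsInteraction χ θ rho ξ n P z a y) (t : ℕ) :
    Measurable fun o => ((hist z a y t o, z t o), a t o) :=
  ((measurable_hist hI.measurable_context hI.measurable_action
    hI.measurable_observation t).prodMk (hI.measurable_context t)).prodMk (hI.measurable_action t)

variable [IsProbabilityMeasure χ] [IsProbabilityMeasure P]

/-- Independence of the fresh context makes the law of history and context a product; the action is
then integrated out through the policy kernel. -/
theorem IsInteraction.lintegral_eq (hI : G.IsInteraction χ θ rho ξ n P z a y) {t : ℕ} (ht : t < n)
    [IsMarkovKernel (ξ t)] {f : (History Z A m t × Z) × A → ℝ≥0∞} (hf : Measurable f) :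
    ∫⁻ o, f ((hist z a y t o, z t o), a t o) ∂P =
      ∫⁻ h, ∫⁻ x, ∫⁻ e, f ((h, x), e) ∂(ξ t (h, x)) ∂χ ∂(P.map (hist z a y t)) := by
  have hh := measurable_hist hI.measurable_context hI.measurable_action hI.measurable_observation t
  have hz := hI.measurable_context t
  have hprod : P.map (fun o => (hist z a y t o, z t o)) = (P.map (hist z a y t)).prod χ := by
    rw [(indepFun_iff_map_prod_eq_prod_map_map hh.aemeasurable hz.aemeasurable).1
      (hI.context_indep t ht), hI.context_law t ht]
  have : IsProbabilityMeasure (P.map (hist z a y t)) :=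
    Measure.isProbabilityMeasure_map hh.aemeasurable
  rw [← lintegral_map hf ((hh.prodMk hz).prodMk (hI.measurable_action t)), hI.action_law t ht,
    hprod, Measure.lintegral_compProd hf, lintegral_prod _ hf.lintegral_kernel_prod_right'.aemeasurable]

variable [CompactSpace A] [TopologicalSpace.MetrizableSpace A] [BorelSpace A]

/-- The norm assumptions concern available actions only, so bounds along the trajectory hold almost
surely through this statement. -/
theorem IsInteraction.ae_mem_avail (hI : G.IsInteraction χ θ rho ξ n P z a y)
    (hids : G.IsContextualIDS lam B rho χ ξ) {t : ℕ} (ht : t < n) :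
    ∀ᵐ o ∂P, a t o ∈ G.avail (z t o) := by
  have := hids.isMarkov t
  let s : Set ((History Z A m t × Z) × A) := {p | p.2 ∈ G.avail p.1.2}
  have hs : MeasurableSet s :=
    (show Measurable fun p : (History Z A m t × Z) × A => (p.1.2, p.2) by fun_prop)
      G.measurableSet_mem_avail
  let f : (History Z A m t × Z) × A → ℝ≥0∞ := sᶜ.indicator fun _ => 1
  have hf : Measurable f := measurable_const.indicator hs.compl
  have h1 := hI.lintegral_eq ht hf
  have h2 : ∀ h x, ∫⁻ e, f ((h, x), e) ∂(ξ t (h, x)) = 0 := by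
    intro h x
    refine (lintegral_eq_zero_iff (hf.comp measurable_prodMk_left)).2 ?_
    have h3 : ξ t (h, x) (G.avail x)ᶜ = 0 := (hids.mem_kernels t h).2 x
    filter_upwards [mem_ae_iff.2 h3] with e he
    have he' : ((h, x), e) ∉ sᶜ := fun hn => hn he
    have hz0 : f ((h, x), e) = 0 := Set.indicator_of_notMem he' _
    exact hz0
  simp only [h2, lintegral_zero] at h1
  filter_upwards [(lintegral_eq_zero_iff (hf.comp (hI.measurable_triple t))).1 h1] with o ho
  by_contra hn
  have hmem : ((hist z a y t o, z t o), a t o) ∈ sᶜ := hn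
  have hone : f ((hist z a y t o, z t o), a t o) = 1 := Set.indicator_of_mem hmem _
  exact one_ne_zero (hone.symm.trans ho)

variable (hI : G.IsInteraction χ θ rho ξ n P z a y) (hids : G.IsContextualIDS lam B rho χ ξ)
  (hlam : 0 < lam) {L : ℝ} (hL : L ^ 2 ≤ lam)
  (hobs : ∀ x, ∀ b ∈ G.avail x, ∀ v, ‖app (G.obs x b) v‖ ≤ L * ‖v‖)
  (hfeat : ∀ x, ∀ b ∈ G.avail x, ∀ c ∈ G.avail x, ‖G.feat x b - G.feat x c‖ ≤ 1)

include hI hids hlam hL hobs in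
theorem IsInteraction.integrable_infoGain {t : ℕ} (ht : t < n) :
    Integrable (fun o => G.infoGain lam (hist z a y t o) (a t o) (z t o)) P := by
  refine Integrable.of_bound (C := (d : ℝ) / 2)
    ((G.measurable_infoGain lam t).comp (hI.measurable_triple t)).aestronglyMeasurable ?_
  filter_upwards [hI.ae_mem_avail hids ht] with o ho
  rw [Real.norm_of_nonneg (G.infoGain_nonneg _ hlam _ _)]
  exact G.infoGain_le _ hlam hL (hobs _ _ ho)

include hI hids hlam hL hobs in
theorem IsInteraction.integrable_beta (hB : 0 ≤ B) (hrho : 0 ≤ rho) {t : ℕ} (ht : t < n) :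
    Integrable (fun o => G.beta lam B rho (hist z a y t o)) P := by
  have hh := measurable_hist hI.measurable_context hI.measurable_action hI.measurable_observation t
  refine Integrable.of_bound
    (C := (rho * √(2 * Real.log (1 / (1 / ((t : ℝ) + 1) ^ 2)) + 2 * (t * (d / 2))) + √lam * B) ^ 2)
    ((G.measurable_beta lam B rho t).comp hh).aestronglyMeasurable ?_
  have hall : ∀ᵐ o ∂P, ∀ s : Fin t, a s o ∈ G.avail (z s o) :=
    ae_all_iff.2 fun s => hI.ae_mem_avail hids (s.2.trans ht)
  filter_upwards [hall] with o ho
  rw [Real.norm_of_nonneg (G.beta_nonneg _ _ _ _), beta_eq]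
  refine pow_le_pow_left₀ (G.radius_nonneg _ hB hrho) ?_ 2
  have h1 : G.totalInfo lam z a y t o ≤ t * (d / 2) := by
    refine (Finset.sum_le_card_nsmul _ _ ((d : ℝ) / 2) fun s hs => ?_).trans (by simp)
    exact G.infoGain_le _ hlam hL (hobs _ _ (ho ⟨s, Finset.mem_range.1 hs⟩))
  rw [radius, G.log_det_gram_hist hlam]
  gcongr
  linarith

include hI hids hfeat in
theorem IsInteraction.integrable_gap {t : ℕ} (ht : t < n) :
    Integrable (fun o => G.gap θ (a t o) (z t o)) P := by
  have hm : Measurable fun o => G.gap θ (a t o) (z t o) :=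
    G.measurable_gap.comp ((hI.measurable_context t).prodMk (hI.measurable_action t))
  refine Integrable.of_bound (C := G.maxGap θ) hm.aestronglyMeasurable ?_
  filter_upwards [hI.ae_mem_avail hids ht] with o ho
  rw [Real.norm_of_nonneg (G.gap_nonneg hfeat ho)]
  exact G.gap_le_maxGap hfeat ho

include hI hids hlam hL hobs hfeat in
/-- The expected regret of a round. -/
theorem IsInteraction.integral_gap_le (hB : ‖θ‖ ≤ B) (hrho : 0 ≤ rho) {α' : ℝ} (hα0 : 0 ≤ α')
    (hα : G.alignment χ < ENNReal.ofReal α') {t : ℕ} (ht : t < n) :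
    ∫ o, G.gap θ (a t o) (z t o) ∂P ≤
      (256 * α' * (∫ o, G.beta lam B rho (hist z a y (n - 1) o) ∂P) * G.maxGap θ *
        ∫ o, G.infoGain lam (hist z a y t o) (a t o) (z t o) ∂P) ^ (1 / 3 : ℝ) +
      G.maxGap θ * (1 / ((t : ℝ) + 1) ^ 2) := by
  have hZ : Nonempty Z := nonempty_of_isProbabilityMeasure χ
  have hB0 : 0 ≤ B := (norm_nonneg θ).trans hB
  have := hids.isMarkov t
  have hh := measurable_hist hI.measurable_context hI.measurable_action hI.measurable_observation t
  have hμ : IsProbabilityMeasure (P.map (hist z a y t)) :=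
    Measure.isProbabilityMeasure_map hh.aemeasurable
  set D := G.maxGap θ
  have hD : 0 ≤ D := G.maxGap_nonneg hfeat
  set b := ∫ o, G.beta lam B rho (hist z a y (n - 1) o) ∂P
  set i := ∫ o, G.infoGain lam (hist z a y t o) (a t o) (z t o) ∂P
  have hb0 : 0 ≤ b := integral_nonneg fun o => G.beta_nonneg _ _ _ _
  have hi0 : 0 ≤ i := integral_nonneg fun o => G.infoGain_nonneg _ hlam _ _
  let good : Set (History Z A m t) := {h | θ ∈ G.confSet lam B rho h}
  have hgood : MeasurableSet good := G.measurableSet_mem_confSet θ lam B rho t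
  have hgapm : Measurable fun p : (History Z A m t × Z) × A =>
      ENNReal.ofReal (G.gap θ p.2 p.1.2) := by
    have : Measurable fun p : (History Z A m t × Z) × A => (p.1.2, p.2) := by fun_prop
    exact ENNReal.measurable_ofReal.comp (G.measurable_gap.comp this)
  let x : History Z A m t → ℝ≥0∞ := fun h =>
    ∫⁻ w, ∫⁻ e, ENNReal.ofReal (G.gap θ e w) ∂(ξ t (h, w)) ∂χ
  let K : History Z A m t → ℝ≥0∞ := fun h =>
    ENNReal.ofReal (256 * α' * G.beta lam B rho h * D)
  let I : History Z A m t → ℝ≥0∞ := fun h => G.infoGainAvg lam χ h ((ξ t).sectR h)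
  have hIm' : Measurable fun p : (History Z A m t × Z) × A =>
      ENNReal.ofReal (G.infoGain lam p.1.1 p.2 p.1.2) :=
    ENNReal.measurable_ofReal.comp (G.measurable_infoGain lam t)
  have hKm : Measurable K :=
    ENNReal.measurable_ofReal.comp (((G.measurable_beta lam B rho t).const_mul _).mul_const _)
  have hIm : Measurable I :=
    (hIm'.lintegral_kernel_prod_right' (κ := ξ t)).lintegral_prod_right'
  have hgoodpart : ∫⁻ o, (hist z a y t ⁻¹' good).indicator
      (fun o => ENNReal.ofReal (G.gap θ (a t o) (z t o))) o ∂P ≤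
        ENNReal.ofReal ((256 * α' * b * D * i) ^ (1 / 3 : ℝ)) := by
    let f : (History Z A m t × Z) × A → ℝ≥0∞ :=
      ((fun p => p.1.1) ⁻¹' good).indicator fun p => ENNReal.ofReal (G.gap θ p.2 p.1.2)
    have hf : Measurable f := hgapm.indicator
      ((show Measurable fun p : (History Z A m t × Z) × A => p.1.1 by fun_prop) hgood)
    have hpt : ∀ h, ∫⁻ w, ∫⁻ e, f ((h, w), e) ∂(ξ t (h, w)) ∂χ ≤
        K h ^ (1 / 3 : ℝ) * I h ^ (1 / 3 : ℝ) := by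
      intro h
      by_cases hg : h ∈ good
      · have h1 : ∀ w e, f ((h, w), e) = ENNReal.ofReal (G.gap θ e w) := fun w e =>
          Set.indicator_of_mem (show ((h, w), e) ∈ (fun p : (History Z A m t × Z) × A =>
            p.1.1) ⁻¹' good from hg) _
        simp only [h1]
        have h2 := hids.lintegral_gap_cube_le hg hB0 hrho hlam hL hobs hfeat hα0 hα
        rw [← ENNReal.mul_rpow_of_nonneg _ _ (by norm_num)]
        have h3 := ENNReal.rpow_le_rpow h2 (by norm_num : (0 : ℝ) ≤ 1 / 3)
        rw [← ENNReal.rpow_natCast, ← ENNReal.rpow_mul] at h3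
        norm_num at h3 ⊢
        exact h3
      · have h1 : ∀ w e, f ((h, w), e) = 0 := fun w e =>
          Set.indicator_of_notMem (show ((h, w), e) ∉ (fun p : (History Z A m t × Z) × A =>
            p.1.1) ⁻¹' good from hg) _
        simp [h1]
    -- By monotonicity β is replaced by its value after n - 1 rounds, which is the coefficient of
    -- round n.
    have hK : ∫⁻ h, K h ∂(P.map (hist z a y t)) ≤ ENNReal.ofReal (256 * α' * b * D) := by
      rw [lintegral_map hKm hh]
      have hint := hI.integrable_beta hids hlam hL hobs hB0 hrho (by omega : n - 1 < n)
      have h1 : 256 * α' * b * D =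
          ∫ o, 256 * α' * G.beta lam B rho (hist z a y (n - 1) o) * D ∂P := by
        rw [integral_mul_const, integral_const_mul]
      rw [h1, ofReal_integral_eq_lintegral_ofReal ((hint.const_mul _).mul_const _)
        (Filter.Eventually.of_forall fun o => by
          have := G.beta_nonneg (hist z a y (n - 1) o) lam B rho
          simp only [Pi.zero_apply]
          positivity)]
      refine lintegral_mono fun o => ENNReal.ofReal_le_ofReal ?_
      have := G.beta_hist_mono (z := z) (a := a) (y := y) hlam hB0 hrho (by omega : t ≤ n - 1) o
      gcongr
    have hIint : ∫⁻ h, I h ∂(P.map (hist z a y t)) = ENNReal.ofReal i := by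
      have h1 := hI.lintegral_eq ht hIm'
      rw [ofReal_integral_eq_lintegral_ofReal (hI.integrable_infoGain hids hlam hL hobs ht)
        (Filter.Eventually.of_forall fun o => G.infoGain_nonneg _ hlam _ _), h1]
      rfl
    -- The constant function 1 takes up the third exponent, so the expectations of β and of the
    -- information appear as separate factors.
    have hholder := ENNReal.lintegral_prod_norm_pow_le (μ := P.map (hist z a y t))
      (Finset.univ : Finset (Fin 3)) (f := ![K, I, fun _ => 1])
      (fun j _ => by
        fin_cases j
        · exact hKm.aemeasurable
        · exact hIm.aemeasurable
        · exact aemeasurable_const) (p := fun _ => 1 / 3) (by simp) (fun _ _ => by norm_num)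
    simp only [Fin.prod_univ_three, Matrix.cons_val_zero, Matrix.cons_val_one, Matrix.cons_val,
      ENNReal.one_rpow, mul_one, lintegral_one, measure_univ] at hholder
    calc _ = ∫⁻ o, f ((hist z a y t o, z t o), a t o) ∂P := rfl
      _ = ∫⁻ h, ∫⁻ w, ∫⁻ e, f ((h, w), e) ∂(ξ t (h, w)) ∂χ ∂(P.map (hist z a y t)) :=
        hI.lintegral_eq ht hf
      _ ≤ ∫⁻ h, K h ^ (1 / 3 : ℝ) * I h ^ (1 / 3 : ℝ) ∂(P.map (hist z a y t)) :=
        lintegral_mono hpt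
      _ ≤ _ := hholder
      _ ≤ ENNReal.ofReal (256 * α' * b * D) ^ (1 / 3 : ℝ) * ENNReal.ofReal i ^ (1 / 3 : ℝ) := by
        rw [hIint]
        gcongr
      _ = _ := by
        rw [← ENNReal.mul_rpow_of_nonneg _ _ (by norm_num), ← ENNReal.ofReal_mul (by positivity),
          ENNReal.ofReal_rpow_of_nonneg (by positivity) (by norm_num)]
  have hbadpart : ∫⁻ o, (hist z a y t ⁻¹' good)ᶜ.indicator
      (fun o => ENNReal.ofReal (G.gap θ (a t o) (z t o))) o ∂P ≤
        ENNReal.ofReal (D * (1 / ((t : ℝ) + 1) ^ 2)) := by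
    rw [lintegral_indicator (hh hgood).compl, ENNReal.ofReal_mul hD]
    calc _ ≤ ∫⁻ _ in (hist z a y t ⁻¹' good)ᶜ, ENNReal.ofReal D ∂P := by
          refine lintegral_mono_ae (ae_restrict_of_ae ?_)
          filter_upwards [hI.ae_mem_avail hids ht] with o ho
          exact ENNReal.ofReal_le_ofReal (G.gap_le_maxGap hfeat ho)
      _ ≤ _ := by
          rw [lintegral_const, Measure.restrict_apply_univ]
          gcongr
          exact hI.measure_notMem_confSet_le hlam hrho hB t ht.le
  have hsum : ENNReal.ofReal (∫ o, G.gap θ (a t o) (z t o) ∂P) ≤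
      ENNReal.ofReal ((256 * α' * b * D * i) ^ (1 / 3 : ℝ) + D * (1 / ((t : ℝ) + 1) ^ 2)) := by
    rw [ofReal_integral_eq_lintegral_ofReal (hI.integrable_gap hids hfeat ht)
      (by
        filter_upwards [hI.ae_mem_avail hids ht] with o ho using G.gap_nonneg hfeat ho),
      ENNReal.ofReal_add (by positivity) (by positivity)]
    refine le_trans (le_of_eq ?_) (add_le_add hgoodpart hbadpart)
    rw [← lintegral_add_left]
    · exact lintegral_congr fun o => (congrFun (Set.indicator_self_add_compl
      (hist z a y t ⁻¹' good) fun o => ENNReal.ofReal (G.gap θ (a t o) (z t o))) o).symm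
    · exact (hgapm.comp (hI.measurable_triple t)).indicator (hh hgood)
  exact (ENNReal.ofReal_le_ofReal_iff (by positivity)).1 hsum

include hI hids hlam hL hobs hfeat in
theorem IsInteraction.integral_regret_le (hB : ‖θ‖ ≤ B) (hrho : 0 ≤ rho) {α' : ℝ} (hα0 : 0 ≤ α')
    (hα : G.alignment χ < ENNReal.ofReal α') :
    ∫ o, G.regret θ z a n o ∂P ≤ (n : ℝ) ^ (2 / 3 : ℝ) *
      (256 * α' * (∫ o, G.beta lam B rho (hist z a y (n - 1) o) ∂P) * G.maxGap θ *
        ∫ o, G.totalInfo lam z a y n o ∂P) ^ (1 / 3 : ℝ) + 2 * G.maxGap θ := by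
  have hZ : Nonempty Z := nonempty_of_isProbabilityMeasure χ
  have hD : 0 ≤ G.maxGap θ := G.maxGap_nonneg hfeat
  have hb0 : 0 ≤ ∫ o, G.beta lam B rho (hist z a y (n - 1) o) ∂P :=
    integral_nonneg fun o => G.beta_nonneg _ _ _ _
  unfold regret totalInfo
  rw [integral_finsetSum _ fun t ht => hI.integrable_gap hids hfeat (Finset.mem_range.1 ht),
    integral_finsetSum _ fun t ht =>
      hI.integrable_infoGain hids hlam hL hobs (Finset.mem_range.1 ht), Finset.mul_sum]
  refine (Finset.sum_le_sum fun t ht => hI.integral_gap_le hids hlam hL hobs hfeat hB hrho hα0 hα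
    (Finset.mem_range.1 ht)).trans ?_
  rw [Finset.sum_add_distrib, ← Finset.mul_sum, mul_comm 2]
  refine add_le_add (sum_cbrt_le n fun t => ?_) (by gcongr; exact sum_inv_sq_le_two n)
  have : 0 ≤ ∫ o, G.infoGain lam (hist z a y t o) (a t o) (z t o) ∂P :=
    integral_nonneg fun o => G.infoGain_nonneg _ hlam _ _
  positivity

end ContextualGame

end LinearPM
end

theorem mainTheorem6 :
    ∃ C : ℝ, ∀ (Z A Ω : Type*) [MeasurableSpace Z]
      [TopologicalSpace A] [CompactSpace A] [TopologicalSpace.MetrizableSpace A]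
      [MeasurableSpace A] [BorelSpace A] [MeasurableSpace Ω]
      (d m n : ℕ) (G : LinearPM.ContextualGame Z A d m)
      (χ : Measure Z) [IsProbabilityMeasure χ] (P : Measure Ω) [IsProbabilityMeasure P]
      (θ : LinearPM.Vec d) (L B lam rho : ℝ)
      (ξ : ∀ t : ℕ, Kernel (LinearPM.History Z A m t × Z) A)
      (z : ℕ → Ω → Z) (a : ℕ → Ω → A) (y : ℕ → Ω → LinearPM.Vec m),
      1 ≤ n → 0 ≤ rho → 0 < lam → L ^ 2 ≤ lam → ‖θ‖ ≤ B →
      (∀ x, ∀ b ∈ G.avail x, ∀ v, ‖LinearPM.app (G.obs x b) v‖ ≤ L * ‖v‖) →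
      (∀ x, ∀ b ∈ G.avail x, ∀ c ∈ G.avail x, ‖G.feat x b - G.feat x c‖ ≤ 1) →
      G.alignment χ ≠ ∞ →
      G.IsContextualIDS lam B rho χ ξ →
      G.IsInteraction χ θ rho ξ n P z a y →
      Integrable (G.regret θ z a n) P ∧
      ∫ o, G.regret θ z a n o ∂P ≤
        (n : ℝ) ^ (2 / 3 : ℝ) *
          (54 * (G.alignment χ).toReal
            * (∫ o, G.beta lam B rho (LinearPM.ContextualGame.hist z a y (n - 1) o) ∂P)
            * (∫ o, G.totalInfo lam z a y n o ∂P)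
            * (G.maxGap θ + 4 * B)) ^ (1 / 3 : ℝ)
        + C * G.maxGap θ := by
  -- A bound for ∑ 1/(t + 1)², the total failure probability of the confidence sets.
  refine ⟨2, ?_⟩
  intro Z A Ω _ _ _ _ _ _ _ d m n G χ _ P _ θ L B lam rho ξ z a y _ hrho hlam hL hB hobs hfeat hα
    hids hI
  have hZ : Nonempty Z := nonempty_of_isProbabilityMeasure χ
  refine ⟨integrable_finsetSum _ fun t ht =>
    hI.integrable_gap hids hfeat (Finset.mem_range.1 ht), ?_⟩
  set α := (G.alignment χ).toReal
  have hα0 : 0 ≤ α := ENNReal.toReal_nonneg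
  set b := ∫ o, G.beta lam B rho (LinearPM.ContextualGame.hist z a y (n - 1) o) ∂P
  set g := ∫ o, G.totalInfo lam z a y n o ∂P
  have hb0 : 0 ≤ b := integral_nonneg fun o => G.beta_nonneg _ _ _ _
  have hg0 : 0 ≤ g := integral_nonneg fun o =>
    Finset.sum_nonneg fun t _ => G.infoGain_nonneg _ hlam _ _
  have hD : 0 ≤ G.maxGap θ := G.maxGap_nonneg hfeat
  have hDB : G.maxGap θ ≤ B := (G.maxGap_le hfeat).trans hB
  -- The bound is available for constants strictly above α; let them decrease to α.
  have hlim : Filter.Tendsto (fun k : ℕ => (n : ℝ) ^ (2 / 3 : ℝ) *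
      (256 * (α + 1 / ((k : ℝ) + 1)) * b * G.maxGap θ * g) ^ (1 / 3 : ℝ) + 2 * G.maxGap θ)
      Filter.atTop (nhds ((n : ℝ) ^ (2 / 3 : ℝ) *
        (256 * (α + 0) * b * G.maxGap θ * g) ^ (1 / 3 : ℝ) + 2 * G.maxGap θ)) := by
    refine ((Filter.Tendsto.rpow_const ?_ (Or.inr (by norm_num))).const_mul _).add_const _
    exact ((((tendsto_one_div_add_atTop_nhds_zero_nat.const_add α).const_mul 256).mul_const
      b).mul_const _).mul_const g
  have hle : ∫ o, G.regret θ z a n o ∂P ≤ (n : ℝ) ^ (2 / 3 : ℝ) *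
      (256 * (α + 0) * b * G.maxGap θ * g) ^ (1 / 3 : ℝ) + 2 * G.maxGap θ := by
    refine ge_of_tendsto' hlim fun k => ?_
    have hk : (0 : ℝ) < 1 / ((k : ℝ) + 1) := by positivity
    refine hI.integral_regret_le hids hlam hL hobs hfeat hB hrho (by positivity) ?_
    rw [← ENNReal.ofReal_toReal hα, ENNReal.ofReal_lt_ofReal_iff (by positivity)]
    exact lt_add_of_pos_right _ hk
  refine hle.trans ?_
  rw [add_zero]
  gcongr ?_ * ?_ ^ _ + _
  have h1 : 0 ≤ α * b * g := by positivity
  -- 256Δ ≤ 54(Δ + 4B) amounts to 202Δ ≤ 216B, which follows from Δ ≤ B.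
  calc 256 * α * b * G.maxGap θ * g = α * b * g * (256 * G.maxGap θ) := by ring
    _ ≤ α * b * g * (54 * (G.maxGap θ + 4 * B)) :=
      mul_le_mul_of_nonneg_left (by linarith) h1
    _ = _ := by ring
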